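/- Let $G$ be a countable connected directed graph (loops and multiple edges allowed) for which the numbers of edges leaving and entering a vertex are bounded uniformly in the vertex, and let $N=\max_{v}\deg_{out}(v)$. For every vertex $v$ let the edges of $G$ leaving $v$ be labelled bijectively by $1,\dots,\deg_{out}(v)$. Let $\widehat G$ be the shadowed graph, obtained by adding to each edge $e$ of $G$ a reversed edge $e^{-1}$, which gets the label $-k$ if $e$ has the label $k$. Let $\mathbb G$ be the graph groupoid of $G$: all finite paths of $\widehat G$ (including the vertices) modulo the reductions $ee^{-1}=v$ and $e^{-1}e=v'$ for $e$ from $v$ to $v'$; write $uw$ for the product "first $u$, then $w$". On the Hilbert space $H_G=\ell^2(\mathbb G)$ with its canonical basis $(\xi_w)_{w\in\mathbb G}$ let $R_w$ be the right multiplication operator, $R_w\xi_u=\xi_{uw}$ if $uw$ is defined and $R_w\xi_u=0$ otherwise; for a finite path $w$ of $\widehat G$ let $R_w$ be the operator of its class in $\mathbb G$. Let $M_G$ and $D_G$ be the closures, in the weak operator topology of $B(H_G)$, of the linear spans of $\{R_w : w\in\mathbb G\}$ and of $\{R_v : v \text{ a vertex}\}$. Let $E$ be the canonical conditional expectation of $M_G$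 onto $D_G$, $E\bigl(\sum_w m_wR_w\bigr)=\sum_{v}m_vR_v$; that is, $E(x)\xi_u=\langle \xi_v,x\xi_v\rangle\,\xi_u$ if $u$ ends at the vertex $v$. For $k\in\{\pm1,\dots,\pm N\}$ let $T_k\in B(H_G)$ be the $k$-th labeling operator, $T_k\xi_w=\sum_e\xi_{we}$, summed over the edges $e$ of $\widehat G$ with label $k$ that start where $w$ ends. The $D_G$-valued joint cumulants are $$k_n(a_1,\dots,a_n)=\sum_{\pi\in NC(n)}\mu(\pi,1_n)\,E_\pi(a_1,\dots,a_n),$$ where $NC(n)$ is the lattice of noncrossing partitions of $\{1,\dots,n\}$ with largest element $1_n$, $\mu$ is its Möbius function, and $E_\pi$ is the moment obtained by applying $E$ along the nested blocks of $\pi$; e.g. $E_\pi(a_1,\dots,a_5)=E(a_1E(a_2a_3)a_4)E(a_5)$ for $\pi=\{\{1,4\},\{2,3\},\{5\}\}$. For a finite path $w=e_n\cdots e_2e_1$ of $\widehat G$ with edges $e_1,\dots,e_n$ put $$\mu_w=\sum_{\pi}\mu(\pi,1_n),\qquad \pi\in NC(n)\ \text{ with }\ E_\pi(R_{e_1},\dots,R_{e_n})=E(R_w)\neq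 0 .$$ Theorem. Let $n\ge 1$ and $(i_1,\dots,i_n)\in\{\pm1,\dots,\pm N\}^n$. Then $T_{i_1},\dots,T_{i_n}\in M_G$, $k_n(T_{i_1},\dots,T_{i_n})\in D_G$, and $$k_n(T_{i_1},\dots,T_{i_n})=\sum_{w}\mu_w R_w ,$$ where $w$ runs over all closed (non-reduced) paths $w=e_n\cdots e_2e_1$ of length $n$ in $\widehat G$ such that $e_j$ has the label $i_j$ for $j=1,\dots,n$ and the sum of the labels is $0$. The (possibly infinite) sum converges unconditionally in the strong operator topology. -/

import Mathlib

open scoped lp ENNReal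

noncomputable section

namespace LabelingOp

/-! ### Noncrossing partitions and operator-valued cumulants -/

/-- A partition of `{0, …, n-1}` is noncrossing if there are no `a < c < b < d` with `a, b` in one
block and `c, d` in a different block. -/
def IsNoncrossing {n : ℕ} (π : Finpartition (Finset.univ : Finset (Fin n))) : Prop :=
  ∀ P ∈ π.parts, ∀ Q ∈ π.parts, ∀ a ∈ P, ∀ b ∈ P, ∀ c ∈ Q, ∀ d ∈ Q,
    a < c → c < b → b < d → P = Q

/-- `NC(n)`, ordered by refinement (`π ≤ σ` iff each block of `π` lies in a block of `σ`). -/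
abbrev NC (n : ℕ) : Type :=
  {π : Finpartition (Finset.univ : Finset (Fin n)) // IsNoncrossing π}

open Classical in
instance (n : ℕ) : Fintype (NC n) := Subtype.fintype _

open Classical in
instance (n : ℕ) : LocallyFiniteOrder (NC n) := Fintype.toLocallyFiniteOrder

open Classical in
/-- The partition `1_n` with the single block `{0, …, n-1}` (for `n ≥ 1`). -/
def NC.one (n : ℕ) : NC n :=
  ⟨⊤, fun _ hP _ hQ _ _ _ _ _ _ _ _ _ _ _ => Finpartition.parts_top_subsingleton _ hP hQ⟩

open Classical in
/-- The Möbius function `μ(π, σ)` of the lattice `NC(n)`: the convolution inverse of zeta. -/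
def NC.moebius {n : ℕ} (π σ : NC n) : ℂ := IncidenceAlgebra.mu ℂ π σ

section Cumulants

variable {A : Type*} [Ring A]

open Classical in
/-- One step of the evaluation of a nested moment. The stack holds the partial products of the
blocks that are still open, the innermost one first; its last entry is the product of the outer
blocks already evaluated. Reading the letter `a j`, open a new block if `j` is the first element of
its block, and otherwise multiply the innermost partial product by `a j` (for a noncrossing
partition the innermost open block is the block of `j`). If `j` is the last element of its block,
close this block: apply `E` to its product and multiply the enclosing product by the result. -/
def readLetter (E : A → A) {n : ℕ} (π : NC n) (a : Fin n → A) (S : List A) (j : Fin n) : List A :=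
  let S' : List A :=
    if ∀ i ∈ π.1.part j, j ≤ i then a j :: S
    else match S with
      | p :: S₀ => (p * a j) :: S₀
      | [] => []
  if ∀ i ∈ π.1.part j, i ≤ j then
    match S' with
    | p :: q :: S₀ => (q * E p) :: S₀
    | S₀ => S₀
  else S'

/-- The partition-dependent moment `E_π(a₁, …, aₙ)`: `E` applied along the nested blocks of the
noncrossing partition `π`, e.g. `E(a₁ E(a₂ a₃) a₄) E(a₅)` for `π = {{1,4},{2,3},{5}}`. -/
def partMoment (E : A → A) {n : ℕ} (π : NC n) (a : Fin n → A) : A :=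
  ((List.finRange n).foldl (readLetter E π a) [1]).headD 1

/-- The operator-valued cumulant `kₙ(a₁, …, aₙ) = ∑_{π ∈ NC(n)} μ(π, 1ₙ) E_π(a₁, …, aₙ)`. -/
def cumulant [Module ℂ A] (E : A → A) {n : ℕ} (a : Fin n → A) : A :=
  ∑ π : NC n, NC.moebius π (NC.one n) • partMoment E π a

end Cumulants

/-! ### Operators on `ℓ²(ι)` -/

/-- The canonical Hilbert basis vector of `ℓ²(ι)` at `i`. -/
def delta {ι : Type*} (i : ι) : ℓ²(ι, ℂ) :=
  letI := Classical.decEq ι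
  lp.single 2 i 1

section SpanOp

variable {ι X : Type*} (src tgt : X → ι) (c : X → ℂ)

theorem tsum_span_enorm_le {B : ℕ} (hs : ∀ u, (src ⁻¹' {u}).encard ≤ B)
    (ht : ∀ u, (tgt ⁻¹' {u}).encard ≤ B) {C : NNReal} (hc : ∀ x, ‖c x‖ₑ ≤ C) (f : ι → ℂ) :
    ∑' u, ‖∑' x : tgt ⁻¹' {u}, c x * f (src x)‖ₑ ^ 2 ≤ (B * C) ^ 2 * ∑' u, ‖f u‖ₑ ^ 2 := by
  have hfin : ∀ u, Finite (tgt ⁻¹' {u}) := fun u =>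
    Set.finite_coe_iff.2 (Set.finite_of_encard_le_coe (ht u))
  have hfin' : ∀ u, Finite (src ⁻¹' {u}) := fun u =>
    Set.finite_coe_iff.2 (Set.finite_of_encard_le_coe (hs u))
  have key : ∀ u, ‖∑' x : tgt ⁻¹' {u}, c x * f (src x)‖ₑ ^ 2 ≤
      B * C ^ 2 * ∑' x : tgt ⁻¹' {u}, ‖f (src x)‖ₑ ^ 2 := by
    intro u
    have := hfin u
    have := Fintype.ofFinite (tgt ⁻¹' {u})
    have hB : ((Finset.univ : Finset (tgt ⁻¹' {u})).card : ℝ≥0∞) ≤ B := by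
      have h1 : ((Finset.univ : Finset (tgt ⁻¹' {u})).card : ℕ∞) ≤ B := by
        have h2 := ht u
        rw [Set.encard, ENat.card_eq_coe_fintype_card] at h2
        simpa using h2
      exact_mod_cast h1
    rw [tsum_fintype, tsum_fintype]
    have cs := ENNReal.inner_le_Lp_mul_Lq (Finset.univ : Finset (tgt ⁻¹' {u}))
      (fun _ => (1 : ℝ≥0∞)) (fun x => C * ‖f (src x)‖ₑ) (p := 2) (q := 2)
      (Real.HolderConjugate.two_two)
    have h3 : ‖∑ x : tgt ⁻¹' {u}, c x * f (src x)‖ₑ ≤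
        ∑ x : tgt ⁻¹' {u}, 1 * (C * ‖f (src x)‖ₑ) := by
      refine (enorm_sum_le _ _).trans (Finset.sum_le_sum fun x _ => ?_)
      rw [one_mul, enorm_mul]
      gcongr
      exact hc _
    have h4 := pow_le_pow_left' (h3.trans cs) 2
    refine h4.trans ?_
    rw [mul_pow]
    have half : ∀ y : ℝ≥0∞, (y ^ ((1 : ℝ) / 2)) ^ 2 = y := fun y => by
      rw [← ENNReal.rpow_natCast, ← ENNReal.rpow_mul]; norm_num
    rw [half, half]
    simp only [ENNReal.rpow_two, mul_pow, one_pow, Finset.sum_const, nsmul_eq_mul, mul_one]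
    rw [← Finset.mul_sum, ← mul_assoc]
    gcongr
  calc ∑' u, ‖∑' x : tgt ⁻¹' {u}, c x * f (src x)‖ₑ ^ 2
      ≤ ∑' u, B * C ^ 2 * ∑' x : tgt ⁻¹' {u}, ‖f (src x)‖ₑ ^ 2 := ENNReal.tsum_le_tsum key
    _ = B * C ^ 2 * ∑' x, ‖f (src x)‖ₑ ^ 2 := by
        rw [ENNReal.tsum_mul_left]
        congr 1
        exact ENNReal.tsum_fiberwise (fun x => ‖f (src x)‖ₑ ^ 2) tgt
    _ = B * C ^ 2 * ∑' u, ∑' x : src ⁻¹' {u}, ‖f (src x)‖ₑ ^ 2 := by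
        congr 1
        exact (ENNReal.tsum_fiberwise (fun x => ‖f (src x)‖ₑ ^ 2) src).symm
    _ ≤ B * C ^ 2 * ∑' u, B * ‖f u‖ₑ ^ 2 := by
        gcongr with u
        have := hfin' u
        have := Fintype.ofFinite (src ⁻¹' {u})
        have hB : ((Finset.univ : Finset (src ⁻¹' {u})).card : ℝ≥0∞) ≤ B := by
          have h1 : ((Finset.univ : Finset (src ⁻¹' {u})).card : ℕ∞) ≤ B := by
            have h2 := hs u
            rw [Set.encard, ENat.card_eq_coe_fintype_card] at h2
            simpa using h2
          exact_mod_cast h1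
        have h5 : ∀ x : src ⁻¹' {u}, ‖f (src x)‖ₑ ^ 2 = ‖f u‖ₑ ^ 2 := fun x => by
          rw [show src x = u from x.2]
        rw [tsum_fintype, Finset.sum_congr rfl fun x _ => h5 x, Finset.sum_const, nsmul_eq_mul]
        gcongr
    _ = (B * C) ^ 2 * ∑' u, ‖f u‖ₑ ^ 2 := by
        rw [ENNReal.tsum_mul_left]; ring

theorem memℓp_span {B : ℕ} (hs : ∀ u, (src ⁻¹' {u}).encard ≤ B)
    (ht : ∀ u, (tgt ⁻¹' {u}).encard ≤ B) {C : NNReal} (hc : ∀ x, ‖c x‖ₑ ≤ C) (f : ℓ²(ι, ℂ)) :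
    Memℓp (fun u => ∑' x : tgt ⁻¹' {u}, c x * f (src x)) 2 := by
  have h := tsum_span_enorm_le src tgt c hs ht hc f
  have conv : ∀ g : ι → ℂ, (∑' u, ‖g u‖ₑ ^ 2 ≠ ∞) ↔ Summable fun u => ‖g u‖ ^ 2 := by
    intro g
    have e : ∀ u, ‖g u‖ₑ ^ 2 = ((‖g u‖₊ ^ 2 : NNReal) : ℝ≥0∞) := fun u => by
      rw [ENNReal.coe_pow]; rfl
    simp_rw [e]
    rw [ENNReal.tsum_coe_ne_top_iff_summable, ← NNReal.summable_coe]
    simp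
  have hf : Summable fun u => ‖f u‖ ^ 2 := by
    simpa using (memℓp_gen_iff (p := 2) (by norm_num)).1 (lp.memℓp f)
  have hne : ∑' u, ‖∑' x : tgt ⁻¹' {u}, c x * f (src x)‖ₑ ^ 2 ≠ ∞ :=
    ne_top_of_le_ne_top (ENNReal.mul_ne_top
      (ENNReal.pow_ne_top (ENNReal.mul_ne_top (by simp) (by simp))) ((conv _).2 hf)) h
  refine (memℓp_gen_iff (p := 2) (by norm_num)).2 ?_
  simpa using (conv _).1 hne

/-- The bounded operator `A` on `ℓ²(ι)` with `A ξ_i = ∑_{x : src x = i} c x • ξ_{tgt x}`, where `c`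
is bounded and `src`, `tgt` have fibres of bounded size; on functions,
`(A f) u = ∑_{x : tgt x = u} c x * f (src x)` (a finite sum). -/
def spanOp (hs : ∃ B : ℕ, ∀ u, (src ⁻¹' {u}).encard ≤ B)
    (ht : ∃ B : ℕ, ∀ u, (tgt ⁻¹' {u}).encard ≤ B) (hc : ∃ C : ℝ, ∀ x, ‖c x‖ ≤ C) :
    ℓ²(ι, ℂ) →L[ℂ] ℓ²(ι, ℂ) :=
  have hyp : ∃ (B : ℕ) (C : NNReal), (∀ u, (src ⁻¹' {u}).encard ≤ B) ∧
      (∀ u, (tgt ⁻¹' {u}).encard ≤ B) ∧ ∀ x, ‖c x‖ₑ ≤ C := by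
    obtain ⟨B, hB⟩ := hs
    obtain ⟨B', hB'⟩ := ht
    obtain ⟨C, hC⟩ := hc
    refine ⟨max B B', C.toNNReal, fun u => (hB u).trans (by exact_mod_cast le_max_left _ _),
      fun u => (hB' u).trans (by exact_mod_cast le_max_right _ _), fun x => ?_⟩
    rw [← ofReal_norm]
    exact ENNReal.ofReal_le_ofReal (hC x)
  have hfin : ∀ u, Finite (tgt ⁻¹' {u}) := fun u =>
    Set.finite_coe_iff.2 (Set.finite_of_encard_le_coe (ht.choose_spec u))
  LinearMap.mkContinuousOfExistsBound
    { toFun := fun f => ⟨fun u => ∑' x : tgt ⁻¹' {u}, c x * f (src x), by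
        obtain ⟨B, C, h1, h2, h3⟩ := hyp
        exact memℓp_span src tgt c h1 h2 h3 f⟩
      map_add' := fun f g => by
        ext u
        have := hfin u
        have := Fintype.ofFinite (tgt ⁻¹' {u})
        refine (?_ : ∑' x : tgt ⁻¹' {u}, c x * (f (src x) + g (src x)) =
          ∑' x : tgt ⁻¹' {u}, c x * f (src x) + ∑' x : tgt ⁻¹' {u}, c x * g (src x))
        simp [tsum_fintype, mul_add, Finset.sum_add_distrib]
      map_smul' := fun a f => by
        ext u
        have := hfin u
        have := Fintype.ofFinite (tgt ⁻¹' {u})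
        simp [tsum_fintype, Finset.mul_sum, mul_left_comm] }
    (by
      obtain ⟨B, C, h1, h2, h3⟩ := hyp
      refine ⟨B * C, fun f => ?_⟩
      have sq : ∀ g : ℓ²(ι, ℂ), ENNReal.ofReal (‖g‖ ^ 2) = ∑' u, ‖g u‖ₑ ^ 2 := by
        intro g
        have hg : Summable fun u => ‖g u‖ ^ 2 := by
          simpa using (memℓp_gen_iff (p := 2) (by norm_num)).1 (lp.memℓp g)
        have := lp.norm_rpow_eq_tsum (p := 2) (by norm_num) g
        simp only [ENNReal.toReal_ofNat, Real.rpow_two] at this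
        rw [this, ENNReal.ofReal_tsum_of_nonneg (fun _ => by positivity) hg]
        simp [ENNReal.ofReal_pow]
      refine (sq_le_sq₀ (by positivity) (by positivity)).1 ?_
      rw [← ENNReal.ofReal_le_ofReal_iff (by positivity), mul_pow, ENNReal.ofReal_mul (by positivity),
        sq, sq]
      refine (tsum_span_enorm_le src tgt c h1 h2 h3 f).trans (le_of_eq ?_)
      congr 1
      rw [ENNReal.ofReal_pow (by positivity), ENNReal.ofReal_mul (by positivity)]
      simp)

theorem spanOp_apply {hs : ∃ B : ℕ, ∀ u, (src ⁻¹' {u}).encard ≤ B}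
    {ht : ∃ B : ℕ, ∀ u, (tgt ⁻¹' {u}).encard ≤ B} {hc : ∃ C : ℝ, ∀ x, ‖c x‖ ≤ C}
    (f : ℓ²(ι, ℂ)) (u : ι) :
    spanOp src tgt c hs ht hc f u = ∑' x : tgt ⁻¹' {u}, c x * f (src x) := rfl

end SpanOp

/-! ### Graphs, labels, and the graph groupoid

A directed graph (loops and multiple edges allowed) is a quiver `V`; its shadowed graph is
`Quiver.Symmetrify V`, and its graph groupoid (all reduced words, that is, all finite paths of the
shadowed graph modulo `e e⁻¹ = 1`) is the free groupoid `Quiver.FreeGroupoid V`. The vertices of the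
graph are the identities of the groupoid. -/

open CategoryTheory Quiver

universe v u

section Graph

variable (V : Type u) [Quiver.{v} V]

/-- The numbers of edges leaving and entering a vertex are bounded uniformly in the vertex. -/
class BoundedDegree : Prop where
  exists_bound : ∃ B : ℕ, ∀ a : V,
    ENat.card (Quiver.Star a) ≤ B ∧ ENat.card (Quiver.Costar a) ≤ B

/-- Any two vertices are joined by a finite path of the shadowed graph. -/
def IsConnectedGraph : Prop :=
  ∀ a b : Symmetrify V, Nonempty (Quiver.Path a b)

/-- `N = max {deg_out a : a ∈ V(G)}`. -/
def maxOutDegree : ℕ := ⨆ a : V, Nat.card (Quiver.Star a)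

/-- A canonical weighting: for each vertex `a`, the edges leaving `a` are labelled bijectively by
`1, …, deg_out a`. -/
structure CanonicalWeighting where
  label : ∀ {a b : V}, (a ⟶ b) → ℕ
  bijOn : ∀ a : V, Set.BijOn (fun s : Quiver.Star a => label s.2) Set.univ
    (Set.Icc 1 (Nat.card (Quiver.Star a)))

/-- The elements of the graph groupoid. -/
abbrev GraphGroupoid : Type (max u v) := Quiver.Total (Quiver.FreeGroupoid V)

/-- The graph Hilbert space, with Hilbert basis `ξ_w`, `w` in the graph groupoid. -/
abbrev GraphHilbert : Type (max u v) := ℓ²(GraphGroupoid V, ℂ)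

end Graph

section Operators

variable {V : Type u} [Quiver.{v} V]

/-- The label of an edge of the shadowed graph: `k` stands for `l_k`, and a shadow `e⁻¹` has the
label `-k` if `e` has the label `k`. -/
def CanonicalWeighting.slabel (ω : CanonicalWeighting V) {a b : Symmetrify V} : (a ⟶ b) → ℤ
  | Sum.inl e => (ω.label e : ℤ)
  | Sum.inr e => -(ω.label e : ℤ)

/-- The element of the graph groupoid given by a path of the shadowed graph (its reduction). -/
def reduce {a b : Symmetrify V} (p : Quiver.Path a b) :
    (⟨a⟩ : Quiver.FreeGroupoid V) ⟶ ⟨b⟩ :=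
  (CategoryTheory.Quotient.functor (@Quiver.FreeGroupoid.redStep V _)).map p

theorem total_cancel {D : Type*} [Groupoid D] {a b c d : D} {x : c ⟶ a} {y : d ⟶ a} {w : a ⟶ b}
    (h : (⟨c, b, x ≫ w⟩ : Quiver.Total D) = ⟨d, b, y ≫ w⟩) :
    (⟨c, x⟩ : Σ c, c ⟶ a) = ⟨d, y⟩ := by
  simp only [Quiver.Total.mk.injEq, true_and] at h
  obtain ⟨rfl, h⟩ := h
  rw [(cancel_mono _).1 (eq_of_heq h)]

/-- The right multiplication operator: `R_w ξ_u = ξ_{uw}` if `uw` is defined, and `0` otherwise. -/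
def rightMul (w : GraphGroupoid V) : GraphHilbert V →L[ℂ] GraphHilbert V :=
  spanOp (X := Σ c : Quiver.FreeGroupoid V, (c ⟶ w.left))
    (fun x => ⟨x.1, w.left, x.2⟩) (fun x => ⟨x.1, w.right, x.2 ≫ w.hom⟩) (fun _ => 1)
    ⟨1, fun g => Set.encard_le_one_iff.2 (by
      rintro ⟨c, x⟩ ⟨d, y⟩ hx hy
      have h := hx.trans hy.symm
      simp only [Quiver.Total.mk.injEq, true_and] at h
      obtain ⟨rfl, h⟩ := h
      simpa using h)⟩
    ⟨1, fun g => Set.encard_le_one_iff.2 (by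
      rintro ⟨c, x⟩ ⟨d, y⟩ hx hy
      exact total_cancel (hx.trans hy.symm))⟩
    ⟨1, fun _ => by simp⟩

/-- A groupoid element `w`, and an edge `e : a ⟶ b` of label `k` of the shadowed graph starting at
the terminal vertex of `w`. -/
structure LabeledStep (ω : CanonicalWeighting V) (k : ℤ) where
  {a b : Symmetrify V}
  {c : Quiver.FreeGroupoid V}
  w : c ⟶ ⟨a⟩
  e : a ⟶ b
  he : ω.slabel e = k

namespace LabeledStep

variable {ω : CanonicalWeighting V} {k : ℤ}

/-- The element `w`. -/
def src (x : LabeledStep ω k) : GraphGroupoid V := ⟨_, _, x.w⟩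

/-- The element `we`. -/
def tgt (x : LabeledStep ω k) : GraphGroupoid V := ⟨_, _, x.w ≫ reduce x.e.toPath⟩

/-- The edge `e`. -/
def edge (x : LabeledStep ω k) : Quiver.Total (Symmetrify V) := ⟨_, _, x.e⟩

theorem encard_edges_le {B : ℕ} (hB : ∀ a : V, ENat.card (Quiver.Star a) ≤ B ∧
    ENat.card (Quiver.Costar a) ≤ B) (a : V) :
    {t : Quiver.Total (Symmetrify V) | t.left = a}.encard ≤ (B + B : ℕ) ∧
    {t : Quiver.Total (Symmetrify V) | t.right = a}.encard ≤ (B + B : ℕ) := by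
  have bd : ∀ (f : Quiver.Star a ⊕ Quiver.Costar a → Quiver.Total (Symmetrify V))
      (s : Set (Quiver.Total (Symmetrify V))), s ⊆ Set.range f → s.encard ≤ (B + B : ℕ) := by
    intro f s h
    refine (Set.encard_le_encard h).trans ?_
    rw [← Set.image_univ]
    refine (Set.encard_image_le _ _).trans ?_
    rw [Set.encard_univ, ENat.card_sum]
    push_cast
    exact add_le_add (hB a).1 (hB a).2
  constructor
  · apply bd (fun s => s.elim (fun s => ⟨a, s.1, Sum.inl s.2⟩) (fun s => ⟨a, s.1, Sum.inr s.2⟩))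
    rintro ⟨x, y, e⟩ rfl
    rcases e with e | e
    · exact ⟨Sum.inl ⟨y, e⟩, rfl⟩
    · exact ⟨Sum.inr ⟨y, e⟩, rfl⟩
  · apply bd (fun s => s.elim (fun s => ⟨s.1, a, Sum.inr s.2⟩) (fun s => ⟨s.1, a, Sum.inl s.2⟩))
    rintro ⟨x, y, e⟩ rfl
    rcases e with e | e
    · exact ⟨Sum.inr ⟨x, e⟩, rfl⟩
    · exact ⟨Sum.inl ⟨x, e⟩, rfl⟩

theorem src_bound [BoundedDegree V] :
    ∃ B : ℕ, ∀ g, ((src : LabeledStep ω k → GraphGroupoid V) ⁻¹' {g}).encard ≤ B := by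
  obtain ⟨B, hB⟩ := BoundedDegree.exists_bound (V := V)
  refine ⟨B + B, fun g => ?_⟩
  have hinj : Set.InjOn (edge : LabeledStep ω k → _) (src ⁻¹' {g}) := by
    rintro ⟨w, e, he⟩ hx ⟨w', e', he'⟩ hy h
    have h' := Eq.trans hx (Eq.symm hy)
    simp only [edge, Quiver.Total.mk.injEq] at h
    obtain ⟨rfl, rfl, h⟩ := h
    simp only [src] at h'
    obtain ⟨rfl, h'⟩ := h'
    simp_all
  rw [← hinj.encard_image]
  refine (Set.encard_le_encard ?_).trans (encard_edges_le hB g.right.as).1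
  rintro _ ⟨x, rfl, rfl⟩
  rfl

theorem tgt_bound [BoundedDegree V] :
    ∃ B : ℕ, ∀ g, ((tgt : LabeledStep ω k → GraphGroupoid V) ⁻¹' {g}).encard ≤ B := by
  obtain ⟨B, hB⟩ := BoundedDegree.exists_bound (V := V)
  refine ⟨B + B, fun g => ?_⟩
  have hinj : Set.InjOn (edge : LabeledStep ω k → _) (tgt ⁻¹' {g}) := by
    rintro ⟨w, e, he⟩ hx ⟨w', e', he'⟩ hy h
    have h' := Eq.trans hx (Eq.symm hy)
    simp only [edge, Quiver.Total.mk.injEq] at h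
    obtain ⟨rfl, rfl, h⟩ := h
    obtain rfl := eq_of_heq h
    have h'' := total_cancel h'
    simp only [Sigma.mk.injEq] at h''
    obtain ⟨rfl, h''⟩ := h''
    obtain rfl := eq_of_heq h''
    rfl
  rw [← hinj.encard_image]
  refine (Set.encard_le_encard ?_).trans (encard_edges_le hB g.right.as).2
  rintro _ ⟨x, rfl, rfl⟩
  rfl

end LabeledStep

/-- The `k`-th labeling operator: `T_k ξ_w = ∑ ξ_{we}`, summed over all edges `e` of the shadowed
graph with label `k` that start at the terminal vertex of `w`. Thus `T_k = ∑_e R_e` over all edges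
`e` with label `k`, strongly convergent. -/
def labelingOp [BoundedDegree V] (ω : CanonicalWeighting V) (k : ℤ) :
    GraphHilbert V →L[ℂ] GraphHilbert V :=
  spanOp (LabeledStep.src : LabeledStep ω k → _) LabeledStep.tgt (fun _ => 1)
    LabeledStep.src_bound LabeledStep.tgt_bound ⟨1, fun _ => by simp⟩

/-- The vertex `a`, as an element of the graph groupoid. -/
def vertexElt (a : Quiver.FreeGroupoid V) : GraphGroupoid V := ⟨a, a, 𝟙 a⟩

/-- The canonical conditional expectation `E (∑ m_w R_w) = ∑_v m_v R_v` (`v` over the vertices) of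
the right graph von Neumann algebra onto its diagonal subalgebra. The coefficient of `R_v` in an
element `x` is `⟪ξ_v, x ξ_v⟫`, and `R_v ξ_u = ξ_u` if `u` ends at `v`, and `0` otherwise. So `E x`
is the diagonal operator with `(E x) ξ_u = ⟪ξ_v, x ξ_v⟫ ξ_u`, `v` the terminal vertex of `u`; this
formula makes sense for all bounded operators `x`. -/
def condExp (x : GraphHilbert V →L[ℂ] GraphHilbert V) : GraphHilbert V →L[ℂ] GraphHilbert V :=
  spanOp (ι := GraphGroupoid V) id id
    (fun u => inner ℂ (delta (vertexElt u.right)) (x (delta (vertexElt u.right))))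
    ⟨1, fun g => by simp⟩ ⟨1, fun g => by simp⟩
    ⟨‖x‖, fun u => by
      refine (norm_inner_le_norm _ _).trans ?_
      have h : ‖(delta (vertexElt u.right) : GraphHilbert V)‖ = 1 := by
        simp [delta, lp.norm_single]
      simpa [h] using x.le_opNorm (delta (vertexElt u.right))⟩

/-- The closure in the weak operator topology of the linear span of a set of operators. -/
def weakSpan (S : Set (GraphHilbert V →L[ℂ] GraphHilbert V)) :
    Set (GraphHilbert V →L[ℂ] GraphHilbert V) :=
  {x | ContinuousLinearMapWOT.ofCLM x ∈
    closure (ContinuousLinearMapWOT.ofCLM '' (Submodule.span ℂ S : Set _))}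

variable (V) in
/-- The right graph von Neumann algebra `M_G`: the weak closure of `ℂ[𝔾]`, the span of the `R_w`. -/
def graphAlgebra : Set (GraphHilbert V →L[ℂ] GraphHilbert V) :=
  weakSpan (Set.range rightMul)

variable (V) in
/-- The diagonal subalgebra `D_G`: the weakly closed span of the projections `R_v`, `v` a vertex. -/
def diagAlgebra : Set (GraphHilbert V →L[ℂ] GraphHilbert V) :=
  weakSpan (Set.range fun a : Quiver.FreeGroupoid V => rightMul (vertexElt a))

/-! ### Finite paths, their weights, and the coefficients `μ_w` -/

/-- The edges of a path, listed from the last one to the first one. -/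
def edgesRev {a : Symmetrify V} : ∀ {b : Symmetrify V}, Quiver.Path a b →
    List (Quiver.Total (Symmetrify V))
  | _, .nil => []
  | _, .cons p e => ⟨_, _, e⟩ :: edgesRev p

variable (V) in
/-- The (non-reduced) finite paths of the shadowed graph. -/
structure FinPath where
  {src tgt : Symmetrify V}
  path : Quiver.Path src tgt

namespace FinPath

/-- The edges `e₁, …, eₙ` of a path `w = eₙ ⋯ e₂ e₁`. -/
def edges (w : FinPath V) : List (Quiver.Total (Symmetrify V)) := edgesRev w.path

/-- The labels of `e₁, …, eₙ` for a path `w = eₙ ⋯ e₂ e₁`. -/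
def labels (ω : CanonicalWeighting V) (w : FinPath V) : List ℤ :=
  w.edges.map fun t => ω.slabel t.hom

/-- The weight `ω₊(ω(w))`: the initial and the terminal vertex, and the sum of the labels. -/
def weightPlus (ω : CanonicalWeighting V) (w : FinPath V) :
    (Symmetrify V × Symmetrify V) × ℤ :=
  ((w.src, w.tgt), (w.labels ω).sum)

/-- The operator `R_w`, where `w` is first reduced to an element of the graph groupoid. -/
def R (w : FinPath V) : GraphHilbert V →L[ℂ] GraphHilbert V :=
  rightMul ⟨_, _, reduce w.path⟩

/-- The operators `R_{e₁}, …, R_{eₙ}` of a path `w = eₙ ⋯ e₂ e₁`. -/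
def edgeOps (w : FinPath V) (j : Fin w.edges.length) : GraphHilbert V →L[ℂ] GraphHilbert V :=
  rightMul ⟨_, _, reduce (w.edges.get j).hom.toPath⟩

open Classical in
/-- For `w = eₙ ⋯ e₂ e₁`, `μ_w = ∑ μ(π, 1ₙ)` over all `π ∈ NC(n)` with
`E_π(R_{e₁}, …, R_{eₙ}) = E(R_w) ≠ 0`. -/
def mu (w : FinPath V) : ℂ :=
  ∑ π : NC w.edges.length with
      partMoment condExp π w.edgeOps = condExp w.R ∧ condExp w.R ≠ 0,
    NC.moebius π (NC.one _)

/-- The paths `w = eₙ ⋯ e₂ e₁` with labels `l_{i₁}, …, l_{iₙ}` of `e₁, …, eₙ` that are closed and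
have label sum `0`. -/
def zeroLoops (ω : CanonicalWeighting V) {n : ℕ} (i : Fin n → ℤ) : Set (FinPath V) :=
  {w | w.labels ω = List.ofFn i ∧ ∃ a, w.weightPlus ω = ((a, a), 0)}

end FinPath

end Operators

end LabelingOp

end

open LabelingOp

/-!
The labeling operator `T_k` is the strong sum of the operators `R_e` over the edges `e` with the
label `k`. Its matrix coefficients are nonnegative, so all finite partial sums have norm at most
`‖T_k‖` (`boundedStrongLimit_labelingOp`). Multiplication and the conditional expectation are
continuous for strong convergence of bounded families, hence so is each nested moment `E_π`
(`BoundedStrongLimit.partMoment`). As `E_π` is also multilinear (`partMomentMultilinear`),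
`E_π(T_{i₁}, …, T_{iₙ})` is the limit of the sums of `E_π(R_{e₁}, …, R_{eₙ})` over products of finite
sets of edges. The terms are diagonal operators with coefficients in `{0, 1}`, which upgrades this to
unconditional strong convergence over all tuples of edges (`hasSum_edgeMoment`).

It remains to identify the terms. `E` either fixes or kills each operator `R_g`. Therefore every
application of `E` in `E_π(R_{e₁}, …, R_{eₙ})` can be omitted unless it gives `0`, and a nonzero moment
equals `R_{e₁} ⋯ R_{eₙ}` and is fixed by `E` (`partMoment_eq_zero_or_prod`). A nonzero product of this
kind is `R_w` for the path `w = eₙ ⋯ e₁` (`exists_path_of_prod_edgeOp_ne_zero`), so the sum of the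
moments of a tuple weighted by the Möbius function is `μ_w R_w` (`edgeCumulant_eq_mu_smul`). If
`μ_w ≠ 0`, then `w` reduces to a vertex, and therefore is closed with label sum `0`, because the sum
of the labels is a homomorphism on the groupoid (`FinPath.weightPlus_of_mu_ne_zero`).
-/

noncomputable section

namespace LabelingOp

/-! ### The fold computing a nested moment -/

section Fold

variable {A B : Type*} [Ring A] [Ring B] {n : ℕ}

/-- The blocks of `π` that are open after the letters `0, …, m - 1` have been read. -/
def openBlocks (π : NC n) (m : ℕ) : Finset (Finset (Fin n)) :=
  π.1.parts.filter fun P => (∃ i ∈ P, i.val < m) ∧ ∃ i ∈ P, m ≤ i.val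

theorem openBlocks_zero (π : NC n) : openBlocks π 0 = ∅ := by
  simp [openBlocks]

theorem openBlocks_self (π : NC n) : openBlocks π n = ∅ := by
  refine Finset.filter_false_of_mem ?_
  rintro P - ⟨-, i, -, hi⟩
  exact absurd i.2 (not_lt.2 hi)

/-- Only the block of `j` can change its status when the letter `j` is read. -/
theorem exists_card_openBlocks (π : NC n) (j : Fin n) : ∃ c : ℕ,
    (openBlocks π j).card = c + (if ∀ i ∈ π.1.part j, j ≤ i then 0 else 1) ∧
    (openBlocks π (j + 1)).card = c + (if ∀ i ∈ π.1.part j, i ≤ j then 0 else 1) := by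
  have hQ : π.1.part j ∈ π.1.parts := π.1.part_mem.2 (Finset.mem_univ j)
  have hj : j ∈ π.1.part j := π.1.mem_part (Finset.mem_univ j)
  have hne : ∀ P ∈ π.1.parts.erase (π.1.part j), j ∉ P := fun P hP hjP =>
    (Finset.mem_erase.1 hP).1 (π.1.part_eq_of_mem (Finset.mem_erase.1 hP).2 hjP).symm
  have hsplit : ∀ m, openBlocks π m =
      (insert (π.1.part j) (π.1.parts.erase (π.1.part j))).filter
        fun P => (∃ i ∈ P, i.val < m) ∧ ∃ i ∈ P, m ≤ i.val := fun m => by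
    rw [Finset.insert_erase hQ, openBlocks]
  refine ⟨((π.1.parts.erase (π.1.part j)).filter
    fun P => (∃ i ∈ P, i.val < j.val) ∧ ∃ i ∈ P, j.val ≤ i.val).card, ?_, ?_⟩
  · rw [hsplit, Finset.filter_insert]
    have h2 : ∃ i ∈ π.1.part j, j.val ≤ i.val := ⟨j, hj, le_rfl⟩
    by_cases h : ∀ i ∈ π.1.part j, j ≤ i
    · rw [if_pos h, if_neg]
      · rfl
      · rintro ⟨⟨i, hi, hlt⟩, -⟩
        exact absurd (h i hi) (not_le.2 hlt)
    · rw [if_neg h, if_pos, Finset.card_insert_of_notMem (by simp)]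
      push Not at h
      exact ⟨h, h2⟩
  · have hsame : (π.1.parts.erase (π.1.part j)).filter
        (fun P => (∃ i ∈ P, i.val < j.val) ∧ ∃ i ∈ P, j.val ≤ i.val) =
        (π.1.parts.erase (π.1.part j)).filter
        (fun P => (∃ i ∈ P, i.val < j.val + 1) ∧ ∃ i ∈ P, j.val + 1 ≤ i.val) := by
      refine Finset.filter_congr fun P hP => and_congr ?_ ?_
      all_goals
        refine exists_congr fun i => and_congr_right fun hi => ?_
        have : i.val ≠ j.val := fun h => hne P hP (Fin.ext h ▸ hi)
        omega
    rw [hsplit, Finset.filter_insert, hsame]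
    have h2 : ∃ i ∈ π.1.part j, i.val < j.val + 1 := ⟨j, hj, Nat.lt_succ_self _⟩
    by_cases h : ∀ i ∈ π.1.part j, i ≤ j
    · rw [if_pos h, if_neg]
      · rfl
      · rintro ⟨-, i, hi, hlt⟩
        exact absurd (h i hi) (not_le.2 hlt)
    · rw [if_neg h, if_pos, Finset.card_insert_of_notMem (by simp)]
      push Not at h
      exact ⟨h2, h⟩

/-- Induction over the evaluation of a nested moment. The stack always holds one entry more than
there are open blocks, so that a letter which continues a block finds an entry below its own, and
the value is the only entry left at the end. -/
theorem partMoment_induction (E : A → A) (π : NC n) (a : Fin n → A) (Inv : ℕ → List A → Prop)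
    (base : Inv 0 [1])
    (single : ∀ (j : Fin n) p S, Inv j (p :: S) → Inv (j + 1) (p * E (a j) :: S))
    (first : ∀ (j : Fin n) p S, Inv j (p :: S) → Inv (j + 1) (a j :: p :: S))
    (last : ∀ (j : Fin n) p q S, Inv j (p :: q :: S) → Inv (j + 1) (q * E (p * a j) :: S))
    (middle : ∀ (j : Fin n) p q S, Inv j (p :: q :: S) → Inv (j + 1) (p * a j :: q :: S)) :
    Inv n [partMoment E π a] := by
  classical
  have key : ∀ m ≤ n, ∀ S, S = ((List.finRange n).take m).foldl (readLetter E π a) [1] →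
      S.length = (openBlocks π m).card + 1 ∧ Inv m S := by
    intro m
    induction m with
    | zero => rintro - S rfl; simpa [openBlocks_zero] using base
    | succ m ih =>
      rintro hm S rfl
      obtain ⟨hl, hS⟩ := ih (by omega) _ rfl
      have ht : (List.finRange n).take (m + 1) = (List.finRange n).take m ++ [⟨m, hm⟩] := by
        rw [List.take_succ_eq_append_getElem (by simpa using hm)]
        simp
      rw [ht, List.foldl_append, List.foldl_cons, List.foldl_nil]
      generalize ((List.finRange n).take m).foldl (readLetter E π a) [1] = S at hl hS
      obtain ⟨c, hc, hc'⟩ := exists_card_openBlocks π ⟨m, hm⟩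
      simp only at hc hc'
      rw [hc] at hl
      rw [hc']
      match S, hl, hS with
      | [], hl, _ => simp at hl
      | [p], hl, hS =>
        have h1 : ∀ i ∈ π.1.part ⟨m, hm⟩, ⟨m, hm⟩ ≤ i := by
          by_contra h
          simp [h] at hl
        simp only [readLetter, if_pos h1] at hl ⊢
        by_cases h2 : ∀ i ∈ π.1.part ⟨m, hm⟩, i ≤ ⟨m, hm⟩
        · simp only [if_pos h2] at hl ⊢
          exact ⟨by simpa using hl, single ⟨m, hm⟩ p [] hS⟩
        · simp only [if_neg h2] at hl ⊢
          exact ⟨by simpa using hl, first ⟨m, hm⟩ p [] hS⟩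
      | p :: q :: S, hl, hS =>
        by_cases h1 : ∀ i ∈ π.1.part ⟨m, hm⟩, ⟨m, hm⟩ ≤ i <;>
        by_cases h2 : ∀ i ∈ π.1.part ⟨m, hm⟩, i ≤ ⟨m, hm⟩
        · simp only [readLetter, if_pos h1, if_pos h2] at hl ⊢
          exact ⟨by simpa using hl, single ⟨m, hm⟩ p _ hS⟩
        · simp only [readLetter, if_pos h1, if_neg h2] at hl ⊢
          exact ⟨by simpa using hl, first ⟨m, hm⟩ p _ hS⟩
        · simp only [readLetter, if_neg h1, if_pos h2] at hl ⊢
          exact ⟨by simpa using hl, last ⟨m, hm⟩ p q _ hS⟩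
        · simp only [readLetter, if_neg h1, if_neg h2] at hl ⊢
          exact ⟨by simpa using hl, middle ⟨m, hm⟩ p q _ hS⟩
  obtain ⟨hl, h⟩ := key n le_rfl _ rfl
  rw [List.take_of_length_le (by simp)] at hl h
  rw [openBlocks_self, Finset.card_empty, zero_add] at hl
  obtain ⟨x, hx⟩ := List.length_eq_one_iff.1 hl
  rw [partMoment, hx]
  rwa [hx] at h

theorem partMoment_mem (E : A → A) (π : NC n) (a : Fin n → A) (P : A → Prop)
    (one : P 1) (mul : ∀ x y, P x → P y → P (x * y)) (exp : ∀ x, P x → P (E x))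
    (letter : ∀ j, P (a j)) : P (partMoment E π a) := by
  have := partMoment_induction E π a (fun _ S => ∀ x ∈ S, P x) (by simpa using one)
    (by
      intro j p S h
      simp only [List.forall_mem_cons] at h ⊢
      exact ⟨mul _ _ h.1 (exp _ (letter j)), h.2⟩)
    (by
      intro j p S h
      simp only [List.forall_mem_cons] at h ⊢
      exact ⟨letter j, h⟩)
    (by
      intro j p q S h
      simp only [List.forall_mem_cons] at h ⊢
      exact ⟨mul _ _ h.2.1 (exp _ (mul _ _ h.1 (letter j))), h.2.2⟩)
    (by
      intro j p q S h
      simp only [List.forall_mem_cons] at h ⊢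
      exact ⟨mul _ _ h.1 (letter j), h.2⟩)
  simpa using this

theorem map_partMoment (φ : A →* B) (E : A → A) (F : B → B) (h : ∀ x, φ (E x) = F (φ x))
    (π : NC n) (a : Fin n → A) :
    φ (partMoment E π a) = partMoment F π fun j => φ (a j) := by
  have step : ∀ (S : List A) (j : Fin n),
      readLetter F π (fun j => φ (a j)) (S.map φ) j = (readLetter E π a S j).map φ := by
    intro S j
    unfold readLetter
    rcases S with _ | ⟨p, _ | ⟨q, S⟩⟩ <;> dsimp only [List.map] <;> split_ifs <;>
      simp [h]
  have fold : ∀ (l : List (Fin n)) (S : List A),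
      l.foldl (readLetter F π fun j => φ (a j)) (S.map φ) =
        (l.foldl (readLetter E π a) S).map φ := by
    intro l
    induction l with
    | nil => intro S; rfl
    | cons j l ih => intro S; rw [List.foldl_cons, List.foldl_cons, step, ih]
  have := fold (List.finRange n) [1]
  rw [List.map_singleton, map_one] at this
  rw [partMoment, partMoment, this]
  cases (List.finRange n).foldl (readLetter E π a) [1] <;> simp

/-- If `E x ∈ {0, x}` for all the products `x` that occur, then each application of `E` either
makes the nested moment vanish or can be omitted. -/
theorem partMoment_eq_zero_or_prod (E : A → A) (π : NC n) (a : Fin n → A) (P : A → Prop)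
    (E_zero : E 0 = 0) (E_one : E 1 = 1) (E_mul : ∀ x y, E (x * E y) = E x * E y)
    (mul : ∀ x y, P x → P y → P (x * y)) (letter : ∀ j, P (a j))
    (exp : ∀ x, P x → E x = x ∨ E x = 0) :
    partMoment E π a = 0 ∨ (partMoment E π a = (List.ofFn a).prod ∧
      E (partMoment E π a) = partMoment E π a) := by
  -- The entries above the lowest one are products of letters, and the lowest one is fixed by `E`.
  have key := partMoment_induction E π a (fun m S => 0 ∈ S ∨
      (S.reverse.prod = ((List.ofFn a).take m).prod ∧
        ∃ L b, S = L ++ [b] ∧ (∀ x ∈ L, P x) ∧ E b = b))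
  have htake : ∀ j : Fin n, ((List.ofFn a).take (j + 1)).prod =
      ((List.ofFn a).take j).prod * a j := fun j => by
    rw [List.take_succ_eq_append_getElem (by simp)]
    simp
  specialize key (Or.inr ⟨by simp, [], 1, by simp, by simp, E_one⟩)
  specialize key ?_ ?_ ?_ ?_
  · rintro j p S (h | ⟨h1, L, b, hL, hP, hb⟩)
    · rcases List.mem_cons.1 h with rfl | h
      · left; simp
      · left; simp [h]
    · rcases exp _ (letter j) with h | h
      · right
        rw [h, htake, ← h1]
        refine ⟨by simp [mul_assoc], ?_⟩
        cases L with
        | nil =>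
          simp only [List.nil_append, List.cons.injEq] at hL
          obtain ⟨rfl, rfl⟩ := hL
          refine ⟨[], p * a j, by simp, by simp, ?_⟩
          nth_rw 1 [← h]
          rw [E_mul, hb, h]
        | cons q L =>
          simp only [List.cons_append, List.cons.injEq] at hL
          obtain ⟨rfl, rfl⟩ := hL
          simp only [List.forall_mem_cons] at hP
          refine ⟨(p * a j) :: L, b, by simp, ?_, hb⟩
          simp only [List.forall_mem_cons]
          exact ⟨mul _ _ hP.1 (letter j), hP.2⟩
      · left; simp [h]
  · rintro j p S (h | ⟨h1, L, b, hL, hP, hb⟩)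
    · left; simp [h]
    · right
      rw [htake, ← h1]
      refine ⟨by simp [mul_assoc], a j :: L, b, by simp [hL], ?_, hb⟩
      simp only [List.forall_mem_cons]
      exact ⟨letter j, hP⟩
  · rintro j p q S (h | ⟨h1, L, b, hL, hP, hb⟩)
    · rcases List.mem_cons.1 h with rfl | h
      · left; simp [E_zero]
      · rcases List.mem_cons.1 h with rfl | h
        · left; simp
        · left; simp [h]
    · rcases L with _ | ⟨p', _ | ⟨q', L⟩⟩
      · simp at hL
      · simp only [List.cons_append, List.nil_append, List.cons.injEq] at hL
        obtain ⟨rfl, rfl, rfl⟩ := hL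
        rcases exp _ (mul _ _ (hP p (by simp)) (letter j)) with h | h
        · right
          refine ⟨?_, [], q * E (p * a j), by simp, by simp, by rw [E_mul, hb]⟩
          rw [h, htake, ← h1]
          simp [mul_assoc]
        · left; simp [h]
      · simp only [List.cons_append, List.cons.injEq] at hL
        obtain ⟨rfl, rfl, rfl⟩ := hL
        simp only [List.forall_mem_cons] at hP
        rcases exp _ (mul _ _ hP.1 (letter j)) with h | h
        · right
          rw [h, htake, ← h1]
          refine ⟨by simp [mul_assoc], (q * (p * a j)) :: L, b, by simp, ?_, hb⟩
          simp only [List.forall_mem_cons]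
          exact ⟨mul _ _ hP.2.1 (mul _ _ hP.1 (letter j)), hP.2.2⟩
        · left; simp [h]
  · rintro j p q S (h | ⟨h1, L, b, hL, hP, hb⟩)
    · rcases List.mem_cons.1 h with rfl | h
      · left; simp
      · left; simp [h]
    · right
      rw [htake, ← h1]
      refine ⟨by simp [mul_assoc], ?_⟩
      rcases L with _ | ⟨p', L⟩
      · simp at hL
      · simp only [List.cons_append, List.cons.injEq] at hL
        obtain ⟨rfl, hL⟩ := hL
        simp only [List.forall_mem_cons] at hP
        refine ⟨(p * a j) :: L, b, by simp [hL], ?_, hb⟩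
        simp only [List.forall_mem_cons]
        exact ⟨mul _ _ hP.1 (letter j), hP.2⟩
  rcases key with h | ⟨h1, L, b, hL, -, hb⟩
  · exact Or.inl (List.mem_singleton.1 h).symm
  · right
    rw [List.take_of_length_le (by simp)] at h1
    refine ⟨by simpa using h1, ?_⟩
    rcases L with _ | ⟨p, L⟩
    · simp only [List.nil_append, List.cons.injEq] at hL
      rw [hL.1, hb]
    · simp at hL

end Fold

/-! ### Multilinearity of nested moments -/

section Multilinear

variable {A : Type*} [Ring A] [Algebra ℂ A] {n : ℕ}

/-- A map is homogeneous of degree `0` if it is constant, and of degree `1` if it is linear; no map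
is given a higher degree. -/
def HasDegree : ℕ → (A → A) → Prop
  | 0, f => ∃ c, ∀ x, f x = c
  | 1, f => ∃ l : A →ₗ[ℂ] A, ∀ x, f x = l x
  | _, _ => False

theorem HasDegree.mul {d e : ℕ} {f g : A → A} (hf : HasDegree d f) (hg : HasDegree e g)
    (h : d + e ≤ 1) : HasDegree (d + e) (f * g) := by
  match d, e, hf, hg with
  | 0, 0, ⟨c, hc⟩, ⟨c', hc'⟩ => exact ⟨c * c', fun x => by simp [hc, hc']⟩
  | 0, 1, ⟨c, hc⟩, ⟨l, hl⟩ =>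
    exact ⟨LinearMap.mulLeft ℂ c ∘ₗ l, fun x => by simp [hc, hl]⟩
  | 1, 0, ⟨l, hl⟩, ⟨c, hc⟩ =>
    exact ⟨LinearMap.mulRight ℂ c ∘ₗ l, fun x => by simp [hc, hl]⟩
  | 1, 1, _, _ => omega

theorem HasDegree.comp {d : ℕ} {f : A → A} (E : A →ₗ[ℂ] A) (hf : HasDegree d f) :
    HasDegree d (E ∘ f) := by
  match d, hf with
  | 0, ⟨c, hc⟩ => exact ⟨E c, fun x => by simp [hc]⟩
  | 1, ⟨l, hl⟩ => exact ⟨E ∘ₗ l, fun x => by simp [hl]⟩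

/-- A list of homogeneous maps with the given sum of degrees. -/
inductive HasTotalDegree : ℕ → List (A → A) → Prop
  | nil : HasTotalDegree 0 []
  | cons {d e : ℕ} {f : A → A} {L : List (A → A)} (hf : HasDegree d f)
    (hL : HasTotalDegree e L) : HasTotalDegree (d + e) (f :: L)

theorem hasTotalDegree_cons {k : ℕ} {f : A → A} {L : List (A → A)} :
    HasTotalDegree k (f :: L) ↔ ∃ d e, HasDegree d f ∧ HasTotalDegree e L ∧ d + e = k := by
  constructor
  · rintro (_ | ⟨hf, hL⟩)
    exact ⟨_, _, hf, hL, rfl⟩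
  · rintro ⟨d, e, hf, hL, rfl⟩
    exact .cons hf hL

/-- As a function of one of its letters, a nested moment is linear: all entries of the stack are
constant until the letter is read, and from then on exactly one entry is linear in it. -/
theorem exists_linear_partMoment (E : A →ₗ[ℂ] A) (π : NC n) (a : Fin n → A) (j : Fin n) :
    ∃ l : A →ₗ[ℂ] A, ∀ x, partMoment E π (Function.update a j x) = l x := by
  have letter : ∀ k : Fin n, HasDegree (if k = j then 1 else 0)
      (fun x => Function.update a j x k) := by
    intro k
    by_cases h : k = j
    · subst h
      rw [if_pos rfl]
      exact ⟨LinearMap.id, fun x => by simp⟩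
    · rw [if_neg h]
      exact ⟨a k, fun x => by simp [h]⟩
  have count : ∀ k : Fin n, (if j.val < k.val + 1 then 1 else 0) =
      (if j.val < k.val then 1 else 0) + if k = j then 1 else 0 := by
    intro k
    rcases lt_trichotomy j k with h | rfl | h
    · have h' : j.val < k.val := h
      rw [if_pos (by omega), if_pos h', if_neg h.ne']
    · simp
    · have h' : k.val < j.val := h
      rw [if_neg (by omega), if_neg (by omega), if_neg h.ne]
  have le : ∀ k : Fin n, (if j.val < k.val + 1 then 1 else 0) ≤ 1 := by
    intro k; split_ifs <;> simp
  have key := partMoment_induction (A := A → A) (fun f => E ∘ f) π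
    (fun k x => Function.update a j x k)
    (fun m L => HasTotalDegree (if j.val < m then 1 else 0) L)
    (by simpa using HasTotalDegree.cons (d := 0) (f := (1 : A → A)) ⟨1, fun x => rfl⟩ .nil)
    (by
      intro k p S h
      have hk := le k
      rw [count] at hk ⊢
      obtain ⟨d, e, hp, hS, h⟩ := hasTotalDegree_cons.1 h
      rw [← h] at hk ⊢
      rw [add_right_comm]
      exact .cons (hp.mul ((letter k).comp E) (by omega)) hS)
    (by
      intro k p S h
      rw [count, add_comm]
      exact .cons (letter k) h)
    (by
      intro k p q S h
      have hk := le k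
      rw [count] at hk ⊢
      obtain ⟨d, e, hp, hS, h⟩ := hasTotalDegree_cons.1 h
      obtain ⟨d', e', hq, hS', rfl⟩ := hasTotalDegree_cons.1 hS
      rw [← h] at hk ⊢
      rw [show d + (d' + e') + (if k = j then 1 else 0) =
        d' + (d + if k = j then 1 else 0) + e' by omega]
      exact .cons (hq.mul ((hp.mul (letter k) (by omega)).comp E) (by omega)) hS')
    (by
      intro k p q S h
      have hk := le k
      rw [count] at hk ⊢
      obtain ⟨d, e, hp, hS, h⟩ := hasTotalDegree_cons.1 h
      rw [← h] at hk ⊢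
      rw [add_right_comm]
      exact .cons (hp.mul (letter k) (by omega)) hS)
  rw [if_pos j.2] at key
  obtain ⟨d, e, hd, he, h⟩ := hasTotalDegree_cons.1 key
  cases he
  obtain rfl : d = 1 := by omega
  obtain ⟨l, hl⟩ := hd
  refine ⟨l, fun x => ?_⟩
  rw [← hl]
  exact (map_partMoment (Pi.evalMonoidHom (fun _ : A => A) x) (fun f => E ∘ f) E
    (fun f => rfl) π (fun k x => Function.update a j x k)).symm

/-- The nested moment of a noncrossing partition as a multilinear map. -/
def partMomentMultilinear (E : A →ₗ[ℂ] A) (π : NC n) :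
    MultilinearMap ℂ (fun _ : Fin n => A) A where
  toFun := partMoment E π
  map_update_add' := fun {inst} a j x y => by
    obtain rfl : inst = instDecidableEqFin n := Subsingleton.elim _ _
    obtain ⟨l, hl⟩ := exists_linear_partMoment E π a j
    rw [hl, hl, hl, map_add]
  map_update_smul' := fun {inst} a j c x => by
    obtain rfl : inst = instDecidableEqFin n := Subsingleton.elim _ _
    obtain ⟨l, hl⟩ := exists_linear_partMoment E π a j
    rw [hl, hl, map_smul]

end Multilinear

open CategoryTheory Quiver Filter Topology

universe v u

/-! ### Dominated convergence in `ℓ²` -/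

section Dominated

variable {ι α : Type*}

theorem tendsto_lp_of_dominated {l : Filter α} {F : α → ℓ²(ι, ℂ)} {f h : ℓ²(ι, ℂ)}
    (hbound : ∀ a i, ‖F a i‖ ≤ ‖h i‖) (hlim : ∀ i, Tendsto (fun a => F a i) l (𝓝 (f i))) :
    Tendsto F l (𝓝 f) := by
  rcases l.eq_or_neBot with rfl | hl
  · exact tendsto_bot
  have hf : ∀ i, ‖f i‖ ≤ ‖h i‖ := fun i =>
    le_of_tendsto (hlim i).norm (Eventually.of_forall fun a => hbound a i)
  have h2 : Summable fun i => (2 * ‖h i‖) ^ 2 := by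
    simp_rw [mul_pow]
    refine Summable.mul_left _ ?_
    simpa using (lp.hasSum_norm (p := 2) (by norm_num) h).summable
  have key : Tendsto (fun a => ‖F a - f‖ ^ 2) l (𝓝 0) := by
    have hn : ∀ a, ‖F a - f‖ ^ 2 = ∑' i, ‖F a i - f i‖ ^ 2 := fun a => by
      simpa using lp.norm_rpow_eq_tsum (p := 2) (by norm_num) (F a - f)
    simp_rw [hn]
    have h0 : (0 : ℝ) = ∑' _ : ι, (0 : ℝ) := tsum_zero.symm
    rw [h0]
    refine tendsto_tsum_of_dominated_convergence h2 (fun i => ?_)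
      (Eventually.of_forall fun a i => ?_)
    · have := ((hlim i).sub_const (f i)).norm.pow 2
      simpa using this
    · rw [Real.norm_of_nonneg (by positivity)]
      gcongr
      refine (norm_sub_le _ _).trans ?_
      linarith [hbound a i, hf i]
  have key' := key.sqrt
  simp only [Real.sqrt_sq (norm_nonneg _), Real.sqrt_zero] at key'
  exact tendsto_iff_norm_sub_tendsto_zero.2 key'

theorem lp_sum_apply (F : α → ℓ²(ι, ℂ)) (s : Finset α) (i : ι) :
    (∑ a ∈ s, F a) i = ∑ a ∈ s, F a i := by
  rw [lp.coeFn_sum]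
  exact Finset.sum_apply i s fun a => ⇑(F a)

theorem hasSum_lp_of_dominated {F : α → ℓ²(ι, ℂ)} {f h : ℓ²(ι, ℂ)}
    (hbound : ∀ (s : Finset α) i, ‖∑ a ∈ s, F a i‖ ≤ ‖h i‖)
    (hlim : ∀ i, HasSum (fun a => F a i) (f i)) : HasSum F f := by
  refine tendsto_lp_of_dominated (h := h) (fun s i => ?_) fun i => ?_
  · rw [lp_sum_apply]
    exact hbound s i
  · simp_rw [lp_sum_apply]
    exact hlim i

theorem tendsto_lp_apply {l : Filter α} {F : α → ℓ²(ι, ℂ)} {f : ℓ²(ι, ℂ)}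
    (h : Tendsto F l (𝓝 f)) (i : ι) : Tendsto (fun a => F a i) l (𝓝 (f i)) :=
  ((lp.lipschitzWith_one_eval (E := fun _ : ι => ℂ) 2 i).continuous.tendsto f).comp h

theorem delta_apply [DecidableEq ι] (i j : ι) :
    (delta i : ℓ²(ι, ℂ)) j = if j = i then 1 else 0 := by
  simp [delta, lp.single_apply, Pi.single_apply]

theorem norm_delta (i : ι) : ‖(delta i : ℓ²(ι, ℂ))‖ = 1 := by
  simp [delta, lp.norm_single]

theorem inner_delta_left (i : ι) (f : ℓ²(ι, ℂ)) : inner ℂ (delta i) f = f i := by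
  classical
  simp [delta, lp.inner_single_left]

end Dominated

/-! ### The conditional expectation -/

section Expectation

variable {V : Type u} [Quiver.{v} V]

theorem condExp_apply (x : GraphHilbert V →L[ℂ] GraphHilbert V) (f : GraphHilbert V)
    (w : GraphGroupoid V) :
    condExp x f w = x (delta (vertexElt w.right)) (vertexElt w.right) * f w := by
  rw [condExp, spanOp_apply, tsum_eq_single ⟨w, rfl⟩]
  · rw [inner_delta_left]; rfl
  · rintro ⟨y, rfl⟩ h
    exact absurd rfl h

theorem clm_ext {x y : GraphHilbert V →L[ℂ] GraphHilbert V} (h : ∀ f w, x f w = y f w) : x = y := by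
  ext f w
  exact h f w

theorem clm_mul_apply (x y : GraphHilbert V →L[ℂ] GraphHilbert V) (f : GraphHilbert V) :
    (x * y) f = x (y f) := rfl

variable (V) in
/-- The conditional expectation as a linear map. -/
def condExpLinear :
    (GraphHilbert V →L[ℂ] GraphHilbert V) →ₗ[ℂ] (GraphHilbert V →L[ℂ] GraphHilbert V) where
  toFun := condExp
  map_add' x y := clm_ext fun f w => by
    change condExp (x + y) f w = condExp x f w + condExp y f w
    simp only [condExp_apply, ← add_mul]
    rfl
  map_smul' c x := clm_ext fun f w => by
    change condExp (c • x) f w = c * condExp x f w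
    simp only [condExp_apply, ← mul_assoc]
    rfl

theorem condExp_zero : condExp (0 : GraphHilbert V →L[ℂ] GraphHilbert V) = 0 :=
  (condExpLinear V).map_zero

theorem condExp_one : condExp (1 : GraphHilbert V →L[ℂ] GraphHilbert V) = 1 := by
  classical
  refine clm_ext fun f w => ?_
  simp [condExp_apply, delta_apply]

theorem clm_delta_of_diagonal {x : GraphHilbert V →L[ℂ] GraphHilbert V} {c : GraphGroupoid V → ℂ}
    (h : ∀ f w, x f w = c w * f w) (w : GraphGroupoid V) : x (delta w) = c w • delta w := by
  classical
  ext y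
  rw [h]
  change _ = c w * delta w y
  rw [delta_apply]
  split_ifs with hy
  · rw [hy]
  · simp

theorem condExp_mul_condExp (x y : GraphHilbert V →L[ℂ] GraphHilbert V) :
    condExp (x * condExp y) = condExp x * condExp y := by
  refine clm_ext fun f w => ?_
  change _ = condExp x (condExp y f) w
  rw [condExp_apply, condExp_apply, condExp_apply, clm_mul_apply,
    clm_delta_of_diagonal (condExp_apply y), map_smul]
  change y _ _ * x _ _ * _ = _
  simp only [vertexElt]
  ring

theorem norm_apply_delta_le (x : GraphHilbert V →L[ℂ] GraphHilbert V) (w : GraphGroupoid V) :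
    ‖x (delta w) w‖ ≤ ‖x‖ := by
  refine (lp.norm_apply_le_norm (by simp) _ _).trans ?_
  simpa [norm_delta] using x.le_opNorm (delta w)

end Expectation

/-! ### Bounded strong convergence -/

section Strong

variable {V : Type u} [Quiver.{v} V] {α : Type*}

/-- Convergence in the strong operator topology of a norm bounded family of operators. -/
def BoundedStrongLimit (l : Filter α) (F : α → GraphHilbert V →L[ℂ] GraphHilbert V)
    (x : GraphHilbert V →L[ℂ] GraphHilbert V) : Prop :=
  (∃ C, ∀ a, ‖F a‖ ≤ C) ∧ ∀ f, Tendsto (fun a => F a f) l (𝓝 (x f))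

variable {l : Filter α} {F G : α → GraphHilbert V →L[ℂ] GraphHilbert V}
  {x y : GraphHilbert V →L[ℂ] GraphHilbert V}

theorem BoundedStrongLimit.mul (hF : BoundedStrongLimit l F x) (hG : BoundedStrongLimit l G y) :
    BoundedStrongLimit l (F * G) (x * y) := by
  obtain ⟨⟨C, hC⟩, hF⟩ := hF
  obtain ⟨⟨D, hD⟩, hG⟩ := hG
  refine ⟨⟨C * D, fun a => (norm_mul_le _ _).trans ?_⟩, fun f => ?_⟩
  · exact mul_le_mul (hC a) (hD a) (norm_nonneg _) ((norm_nonneg _).trans (hC a))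
  · have h1 : Tendsto (fun a => F a (G a f - y f)) l (𝓝 0) := by
      have h2 := (tendsto_iff_norm_sub_tendsto_zero.1 (hG f)).const_mul C
      rw [mul_zero] at h2
      refine squeeze_zero_norm (fun a => ?_) h2
      exact (F a).le_of_opNorm_le (hC a) _
    have h3 := h1.add (hF (y f))
    simpa using h3

theorem BoundedStrongLimit.condExp (hF : BoundedStrongLimit l F x) :
    BoundedStrongLimit l (fun a => condExp (F a)) (condExp x) := by
  obtain ⟨⟨C, hC⟩, hF⟩ := hF
  have hpt : ∀ a f w, ‖LabelingOp.condExp (F a) f w‖ ≤ ‖((C : ℂ) • f) w‖ := fun a f w => by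
    rw [condExp_apply, norm_mul]
    change _ ≤ ‖(C : ℂ) * f w‖
    have h0 : 0 ≤ C := (norm_nonneg _).trans (hC a)
    rw [norm_mul, Complex.norm_real, Real.norm_of_nonneg h0]
    gcongr
    exact (norm_apply_delta_le _ _).trans (hC a)
  refine ⟨⟨|C|, fun a => ContinuousLinearMap.opNorm_le_bound _ (abs_nonneg _) fun f => ?_⟩,
    fun f => tendsto_lp_of_dominated (fun a => hpt a f) fun w => ?_⟩
  · refine (lp.norm_mono (by simp) (hpt a f)).trans ?_
    rw [norm_smul]
    simp
  · simp_rw [condExp_apply]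
    exact (tendsto_lp_apply (hF _) _).mul_const _

/-- Nested moments are continuous for bounded strong convergence: the convergent families, paired with
their limits, are closed under the operations of the ring of all pairs `(family, operator)`. -/
theorem BoundedStrongLimit.partMoment {n : ℕ} (π : NC n)
    {F : Fin n → α → GraphHilbert V →L[ℂ] GraphHilbert V}
    {x : Fin n → GraphHilbert V →L[ℂ] GraphHilbert V}
    (h : ∀ j, BoundedStrongLimit l (F j) (x j)) :
    BoundedStrongLimit l (fun a => partMoment LabelingOp.condExp π fun j => F j a)
      (partMoment LabelingOp.condExp π x) := by
  let A := GraphHilbert V →L[ℂ] GraphHilbert V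
  let E : (α → A) × A → (α → A) × A :=
    fun p => (fun a => LabelingOp.condExp (p.1 a), LabelingOp.condExp p.2)
  have key := partMoment_mem E π (fun j => (F j, x j)) (fun p => BoundedStrongLimit l p.1 p.2)
    ⟨⟨‖(1 : A)‖, fun _ => le_rfl⟩, fun f => tendsto_const_nhds⟩
    (fun p q hp hq => hp.mul hq) (fun p hp => hp.condExp) h
  have h1 : ∀ a, (LabelingOp.partMoment E π fun j => (F j, x j)).1 a =
      LabelingOp.partMoment LabelingOp.condExp π fun j => F j a := fun a =>
    map_partMoment ((Pi.evalMonoidHom (fun _ : α => A) a).comp (MonoidHom.fst (α → A) A)) E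
      LabelingOp.condExp (fun p => rfl) π _
  have h2 : (LabelingOp.partMoment E π fun j => (F j, x j)).2 =
      LabelingOp.partMoment LabelingOp.condExp π x :=
    map_partMoment (MonoidHom.snd (α → A) A) E LabelingOp.condExp (fun p => rfl) π _
  rw [h2] at key
  rwa [funext h1] at key

theorem mem_weakSpan_of_tendsto [l.NeBot] {S : Set (GraphHilbert V →L[ℂ] GraphHilbert V)}
    (hF : ∀ f, Tendsto (fun a => F a f) l (𝓝 (x f))) (hS : ∀ a, F a ∈ Submodule.span ℂ S) :
    x ∈ weakSpan S := by
  refine mem_closure_of_tendsto (f := fun a => ContinuousLinearMapWOT.ofCLM (F a)) (b := l) ?_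
    (Eventually.of_forall fun a => ⟨F a, hS a, rfl⟩)
  rw [ContinuousLinearMapWOT.tendsto_iff_forall_dual_apply_tendsto]
  exact fun f φ => (φ.continuous.tendsto _).comp (hF f)

theorem BoundedStrongLimit.comp {β : Type*} {l' : Filter β} (hF : BoundedStrongLimit l F x)
    {u : β → α} (hu : Tendsto u l' l) : BoundedStrongLimit l' (fun b => F (u b)) x :=
  ⟨hF.1.imp fun _ hC b => hC (u b), fun f => (hF.2 f).comp hu⟩

end Strong

/-! ### Right multiplication operators -/

section RightMul

variable {V : Type u} [Quiver.{v} V]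

theorem rightMul_apply_comp {a b c : Quiver.FreeGroupoid V} (g : a ⟶ b) (x : c ⟶ a)
    (f : GraphHilbert V) : rightMul ⟨a, b, g⟩ f ⟨c, b, x ≫ g⟩ = f ⟨c, a, x⟩ := by
  rw [rightMul, spanOp_apply, tsum_eq_single ⟨⟨c, x⟩, rfl⟩]
  · simp
  · rintro ⟨⟨d, y⟩, hy⟩ h
    exact absurd (Subtype.ext (total_cancel (w := g) (x := y) (y := x) hy)) h

theorem rightMul_apply_of_ne {g w : GraphGroupoid V} (h : w.right ≠ g.right) (f : GraphHilbert V) :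
    rightMul g f w = 0 := by
  rw [rightMul, spanOp_apply]
  have : IsEmpty ((fun x : Σ c : Quiver.FreeGroupoid V, (c ⟶ g.left) =>
      (⟨x.1, g.right, x.2 ≫ g.hom⟩ : GraphGroupoid V)) ⁻¹' {w}) := by
    refine ⟨?_⟩
    rintro ⟨x, rfl⟩
    exact h rfl
  exact tsum_empty

theorem rightMul_apply {a b c : Quiver.FreeGroupoid V} (g : a ⟶ b) (x : c ⟶ b)
    (f : GraphHilbert V) : rightMul ⟨a, b, g⟩ f ⟨c, b, x⟩ = f ⟨c, a, x ≫ inv g⟩ := by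
  have := rightMul_apply_comp g (x ≫ inv g) f
  simpa using this

theorem exists_comp_eq {a b c : Quiver.FreeGroupoid V} (g : a ⟶ b) (x : c ⟶ b) :
    ∃ y, y ≫ g = x :=
  ⟨x ≫ inv g, by simp⟩

theorem eq_id_of_eq_vertexElt {a : Quiver.FreeGroupoid V} {g : a ⟶ a}
    (h : (⟨a, a, g⟩ : GraphGroupoid V) = vertexElt a) : g = 𝟙 a := by
  simpa [vertexElt] using h

theorem rightMul_mul {a b c : Quiver.FreeGroupoid V} (g : b ⟶ c) (h : a ⟶ b) :
    rightMul (⟨b, c, g⟩ : GraphGroupoid V) * rightMul ⟨a, b, h⟩ = rightMul ⟨a, c, h ≫ g⟩ := by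
  refine clm_ext fun f w => ?_
  rw [clm_mul_apply]
  obtain ⟨d, c', x⟩ := w
  by_cases hc : c' = c
  · subst hc
    rw [rightMul_apply, rightMul_apply, rightMul_apply]
    simp
  · rw [rightMul_apply_of_ne hc, rightMul_apply_of_ne hc]

theorem rightMul_mul_of_ne {g h : GraphGroupoid V} (hne : h.right ≠ g.left) :
    rightMul g * rightMul h = 0 := by
  refine clm_ext fun f w => ?_
  rw [clm_mul_apply]
  obtain ⟨a, b, g⟩ := g
  obtain ⟨d, c, x⟩ := w
  by_cases hc : c = b
  · subst hc
    rw [rightMul_apply, rightMul_apply_of_ne hne.symm]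
    rfl
  · rw [rightMul_apply_of_ne hc]
    rfl

theorem condExp_rightMul_vertexElt (a : Quiver.FreeGroupoid V) :
    condExp (rightMul (vertexElt a)) = rightMul (vertexElt a) := by
  classical
  refine clm_ext fun f w => ?_
  obtain ⟨d, c, x⟩ := w
  rw [condExp_apply]
  by_cases hc : c = a
  · subst hc
    rw [vertexElt, rightMul_apply, rightMul_apply, delta_apply]
    simp
  · rw [rightMul_apply_of_ne hc, rightMul_apply_of_ne (by exact hc)]
    simp

theorem condExp_rightMul_eq_zero {g : GraphGroupoid V} (h : ∀ a, g ≠ vertexElt a) :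
    condExp (rightMul g) = 0 := by
  classical
  refine clm_ext fun f w => ?_
  obtain ⟨d, c, x⟩ := w
  obtain ⟨a, b, g⟩ := g
  rw [condExp_apply]
  by_cases hc : c = b
  · subst hc
    rw [vertexElt, rightMul_apply, delta_apply, if_neg]
    · simp
    · intro heq
      simp only [Total.mk.injEq, true_and] at heq
      obtain ⟨rfl, heq⟩ := heq
      refine h a ?_
      have h1 := eq_of_heq heq
      have h2 := IsIso.hom_inv_id g
      rw [Category.id_comp] at h1
      rw [h1, Category.comp_id] at h2
      rw [h2]
      rfl
  · rw [rightMul_apply_of_ne (by exact hc)]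
    simp

theorem condExp_rightMul_eq_self_or (g : GraphGroupoid V) :
    condExp (rightMul g) = rightMul g ∨ condExp (rightMul g) = 0 := by
  by_cases h : ∃ a, g = vertexElt a
  · obtain ⟨a, rfl⟩ := h
    exact Or.inl (condExp_rightMul_vertexElt a)
  · push Not at h
    exact Or.inr (condExp_rightMul_eq_zero h)

theorem rightMul_ne_zero (g : GraphGroupoid V) : rightMul g ≠ 0 := by
  classical
  intro h
  obtain ⟨a, b, g⟩ := g
  have h1 := rightMul_apply g g (delta (vertexElt a))
  rw [h, delta_apply] at h1
  simp [vertexElt] at h1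

end RightMul

/-! ### Words in the edges -/

section Words

variable {V : Type u} [Quiver.{v} V]

/-- The operator `R_e` of an edge `e` of the shadowed graph. -/
def edgeOp (t : Total (Symmetrify V)) : GraphHilbert V →L[ℂ] GraphHilbert V :=
  rightMul ⟨_, _, reduce t.hom.toPath⟩

theorem reduce_cons {a b c : Symmetrify V} (p : Quiver.Path a b) (e : b ⟶ c) :
    reduce (p.cons e) = reduce p ≫ reduce e.toPath :=
  (CategoryTheory.Quotient.functor (@Quiver.FreeGroupoid.redStep V _)).map_comp
    (X := a) (Y := b) (Z := c) p e.toPath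

theorem edgesRev_ne_nil {a b c : Symmetrify V} (p : Quiver.Path a b) (e : b ⟶ c) :
    edgesRev (p.cons e) ≠ [] := by
  simp [edgesRev]

/-- `R_{e₁} ⋯ R_{eₙ} = R_w` for a path `w = eₙ ⋯ e₁` of positive length. -/
theorem prod_edgeOp_edgesRev {a b : Symmetrify V} (p : Quiver.Path a b) (hp : edgesRev p ≠ []) :
    ((edgesRev p).map edgeOp).prod = rightMul ⟨_, _, reduce p⟩ := by
  induction p with
  | nil => exact absurd rfl hp
  | cons p e ih =>
    rw [edgesRev, List.map_cons, List.prod_cons]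
    cases p with
    | nil => simp [edgesRev, edgeOp, Hom.toPath]
    | cons p e' =>
      rw [ih (edgesRev_ne_nil p e'), reduce_cons (p.cons e')]
      exact rightMul_mul _ _

/-- A nonvanishing product of the operators of edges is the operator of a path. -/
theorem exists_path_of_prod_edgeOp_ne_zero {L : List (Total (Symmetrify V))} (hL : L ≠ [])
    (h : (L.map edgeOp).prod ≠ 0) : ∃ w : FinPath V, w.edges = L := by
  induction L with
  | nil => exact absurd rfl hL
  | cons t L ih =>
    by_cases hL' : L = []
    · subst hL'
      exact ⟨⟨t.hom.toPath⟩, rfl⟩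
    · rw [List.map_cons, List.prod_cons] at h
      obtain ⟨⟨w⟩, rfl⟩ := ih hL' (right_ne_zero_of_mul h)
      rename_i a b
      rw [FinPath.edges, prod_edgeOp_edgesRev w hL', edgeOp] at h
      obtain ⟨c, d, e⟩ := t
      obtain rfl : b = c := by
        by_contra hne
        refine h (rightMul_mul_of_ne fun heq => hne ?_)
        have : (⟨b⟩ : Quiver.FreeGroupoid V) = ⟨c⟩ := heq
        injection this
      exact ⟨⟨w.cons e⟩, rfl⟩

theorem edgesRev_injective {a b a' b' : Symmetrify V} {p : Quiver.Path a b}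
    {q : Quiver.Path a' b'} (hp : edgesRev p ≠ []) (h : edgesRev p = edgesRev q) :
    (⟨p⟩ : FinPath V) = ⟨q⟩ := by
  induction p generalizing b' with
  | nil => exact absurd rfl hp
  | cons p e ih =>
    cases q with
    | nil => exact absurd h hp
    | cons q e' =>
      simp only [edgesRev, List.cons.injEq, Total.mk.injEq] at h
      obtain ⟨⟨h1, h2, h3⟩, h4⟩ := h
      subst h1 h2
      obtain rfl := eq_of_heq h3
      cases p with
      | nil =>
        cases q with
        | nil => rfl
        | cons q e'' => simp [edgesRev] at h4
      | cons p e'' =>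
        have := ih (edgesRev_ne_nil p e'') h4
        simp only [FinPath.mk.injEq, true_and] at this
        obtain ⟨rfl, this⟩ := this
        obtain rfl := eq_of_heq this
        rfl

/-- The sum of the labels, as a functor from the graph groupoid. -/
def labelSum (ω : CanonicalWeighting V) :
    Quiver.FreeGroupoid V ⥤ CategoryTheory.SingleObj (Multiplicative ℤ) :=
  Quiver.FreeGroupoid.lift
    { obj := fun _ => CategoryTheory.SingleObj.star _
      map := fun e => (Multiplicative.ofAdd (ω.label e : ℤ) : Multiplicative ℤ) }

theorem labelSum_reduce (ω : CanonicalWeighting V) {a b : Symmetrify V} (p : Quiver.Path a b) :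
    (labelSum ω).map (reduce p) =
      (Multiplicative.ofAdd ((FinPath.mk p).labels ω).sum : Multiplicative ℤ) := by
  induction p with
  | nil => exact (labelSum ω).map_id _
  | cons p e ih =>
    have hcomp : (labelSum ω).map (reduce (p.cons e)) =
        (labelSum ω).map (reduce p) ≫ (labelSum ω).map (reduce e.toPath) := by
      rw [reduce_cons]
      exact Functor.map_comp _ _ _
    have he : (labelSum ω).map (reduce e.toPath) =
        (Multiplicative.ofAdd (ω.slabel e) : Multiplicative ℤ) := by
      rcases e with e | e
      · exact mul_one (Multiplicative.ofAdd (ω.label e : ℤ))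
      · exact mul_one (Multiplicative.ofAdd (ω.label e : ℤ))⁻¹
    rw [hcomp, ih, he]
    rfl

end Words

/-! ### Labeling operators as strong sums over edges -/

section Labeling

variable {V : Type u} [Quiver.{v} V]

/-- The edges of the shadowed graph with the label `k`. -/
abbrev LabeledEdge (ω : CanonicalWeighting V) (k : ℤ) : Type (max u v) :=
  {t : Quiver.Total (Symmetrify V) // ω.slabel t.hom = k}

/-- The vector of the absolute values of the coordinates. -/
def lpAbs {ι : Type*} (f : ℓ²(ι, ℂ)) : ℓ²(ι, ℂ) :=
  ⟨fun i => (‖f i‖ : ℂ), (memℓp_norm_iff.2 (lp.memℓp f)).mono fun i => by simp⟩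

theorem lpAbs_apply {ι : Type*} (f : ℓ²(ι, ℂ)) (i : ι) : lpAbs f i = (‖f i‖ : ℂ) := rfl

theorem norm_lpAbs_le {ι : Type*} (f : ℓ²(ι, ℂ)) : ‖lpAbs f‖ ≤ ‖f‖ :=
  lp.norm_mono (by simp) fun i => by simp [lpAbs_apply]

theorem rightMul_lpAbs (g : GraphGroupoid V) (f : GraphHilbert V) (w : GraphGroupoid V) :
    rightMul g (lpAbs f) w = (‖rightMul g f w‖ : ℂ) := by
  obtain ⟨a, b, g⟩ := g
  obtain ⟨c, d, x⟩ := w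
  by_cases h : d = b
  · subst h
    rw [rightMul_apply, rightMul_apply, lpAbs_apply]
  · rw [rightMul_apply_of_ne h, rightMul_apply_of_ne h]
    simp

theorem edgeOp_lpAbs (t : Quiver.Total (Symmetrify V)) (f : GraphHilbert V)
    (w : GraphGroupoid V) : edgeOp t (lpAbs f) w = (‖edgeOp t f w‖ : ℂ) :=
  rightMul_lpAbs _ f w

variable [BoundedDegree V]

theorem hasSum_edgeOp_apply (ω : CanonicalWeighting V) (k : ℤ) (f : GraphHilbert V)
    (w : GraphGroupoid V) :
    HasSum (fun t : LabeledEdge ω k => edgeOp t.1 f w) (labelingOp ω k f w) := by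
  -- The steps `(x, e)` with `xe = w` are determined by the edge `e`.
  let g : (LabeledStep.tgt : LabeledStep ω k → GraphGroupoid V) ⁻¹' {w} → LabeledEdge ω k :=
    fun x => ⟨x.1.edge, x.1.he⟩
  have hg : Function.Injective g := by
    rintro ⟨⟨x, e, he⟩, hx⟩ ⟨⟨y, e', he'⟩, hy⟩ h
    have h' := Eq.trans hx (Eq.symm hy)
    simp only [g, LabeledStep.edge, Subtype.mk.injEq, Quiver.Total.mk.injEq] at h
    obtain ⟨rfl, rfl, h⟩ := h
    obtain rfl := eq_of_heq h
    have h'' := total_cancel h'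
    simp only [Sigma.mk.injEq] at h''
    obtain ⟨rfl, h''⟩ := h''
    obtain rfl := eq_of_heq h''
    rfl
  have hfin : Finite ((LabeledStep.tgt : LabeledStep ω k → GraphGroupoid V) ⁻¹' {w}) := by
    obtain ⟨B, hB⟩ := LabeledStep.tgt_bound (ω := ω) (k := k)
    exact Set.finite_coe_iff.2 (Set.finite_of_encard_le_coe (hB w))
  have hval : ∀ x, edgeOp (g x).1 f w = 1 * f x.1.src := by
    rintro ⟨⟨x, e, he⟩, rfl⟩
    rw [one_mul]
    exact rightMul_apply_comp _ _ _
  rw [labelingOp, spanOp_apply]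
  refine (hg.hasSum_iff fun t ht => ?_).1 ?_
  · obtain ⟨⟨a, b, e⟩, he⟩ := t
    obtain ⟨c, d, x⟩ := w
    refine rightMul_apply_of_ne (fun h => ht ?_) f
    obtain rfl : d = ⟨b⟩ := h
    obtain ⟨y, hy⟩ := exists_comp_eq (reduce e.toPath) x
    exact ⟨⟨⟨y, e, he⟩, congrArg (fun z => (⟨c, _, z⟩ : GraphGroupoid V)) hy⟩, rfl⟩
  · simp only [Function.comp_def, hval]
    exact (Summable.of_finite).hasSum

/-- `T_k = ∑_e R_e` with unconditional strong convergence; the partial sums are bounded by the norm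
of `T_k`, since all matrix coefficients are nonnegative. -/
theorem boundedStrongLimit_labelingOp (ω : CanonicalWeighting V) (k : ℤ) :
    BoundedStrongLimit atTop (fun s : Finset (LabeledEdge ω k) => ∑ t ∈ s, edgeOp t.1)
      (labelingOp ω k) := by
  have happ : ∀ (s : Finset (LabeledEdge ω k)) (f : GraphHilbert V),
      (∑ t ∈ s, edgeOp t.1) f = ∑ t ∈ s, edgeOp t.1 f := fun s f =>
    sum_apply s _ f
  have hpt : ∀ (s : Finset (LabeledEdge ω k)) (f : GraphHilbert V) w,
      ‖∑ t ∈ s, edgeOp t.1 f w‖ ≤ ‖labelingOp ω k (lpAbs f) w‖ := by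
    intro s f w
    have h1 := hasSum_edgeOp_apply ω k (lpAbs f) w
    simp only [edgeOp_lpAbs] at h1
    have h2 := Complex.hasSum_re h1
    simp only [Complex.ofReal_re] at h2
    calc ‖∑ t ∈ s, edgeOp t.1 f w‖ ≤ ∑ t ∈ s, ‖edgeOp t.1 f w‖ := norm_sum_le _ _
      _ ≤ (labelingOp ω k (lpAbs f) w).re :=
        sum_le_hasSum s (fun t _ => norm_nonneg _) h2
      _ ≤ _ := Complex.re_le_norm _
  refine ⟨⟨‖labelingOp ω k‖, fun s =>
    ContinuousLinearMap.opNorm_le_bound _ (norm_nonneg _) fun f => ?_⟩, fun f => ?_⟩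
  · refine (lp.norm_mono (y := labelingOp ω k (lpAbs f)) (by simp) fun w => ?_).trans
      (((labelingOp ω k).le_opNorm _).trans ?_)
    · rw [happ, lp_sum_apply]
      exact hpt s f w
    · exact mul_le_mul_of_nonneg_left (norm_lpAbs_le f) (norm_nonneg _)
  · simp only [happ]
    exact hasSum_lp_of_dominated (fun s w => hpt s f w) (hasSum_edgeOp_apply ω k f)

end Labeling

/-! ### Expansion of the moments over tuples of edges -/

section Expansion

variable {V : Type u} [Quiver.{v} V] {n : ℕ}

/-- The operators `R_g` of the elements of the graph groupoid, together with `0` and `1`. They are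
closed under products, and `E` fixes or kills each of them. -/
def IsGroupoidMonomial (x : GraphHilbert V →L[ℂ] GraphHilbert V) : Prop :=
  x = 0 ∨ x = 1 ∨ ∃ g, x = rightMul g

theorem IsGroupoidMonomial.mul {x y : GraphHilbert V →L[ℂ] GraphHilbert V} (hx : IsGroupoidMonomial x)
    (hy : IsGroupoidMonomial y) : IsGroupoidMonomial (x * y) := by
  rcases hx with rfl | rfl | ⟨⟨a, b, g⟩, rfl⟩
  · exact Or.inl (zero_mul y)
  · rwa [one_mul]
  · rcases hy with rfl | rfl | ⟨⟨c, d, h⟩, rfl⟩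
    · exact Or.inl (mul_zero _)
    · exact Or.inr (Or.inr ⟨⟨a, b, g⟩, mul_one _⟩)
    · by_cases hne : d = a
      · subst hne
        exact Or.inr (Or.inr ⟨_, rightMul_mul g h⟩)
      · exact Or.inl (rightMul_mul_of_ne hne)

theorem IsGroupoidMonomial.condExp_eq {x : GraphHilbert V →L[ℂ] GraphHilbert V}
    (hx : IsGroupoidMonomial x) : condExp x = x ∨ condExp x = 0 := by
  rcases hx with rfl | rfl | ⟨g, rfl⟩
  · exact Or.inl condExp_zero
  · exact Or.inl condExp_one
  · exact condExp_rightMul_eq_self_or g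

theorem IsGroupoidMonomial.coeff_eq {x : GraphHilbert V →L[ℂ] GraphHilbert V}
    (hx : IsGroupoidMonomial x) (a : Quiver.FreeGroupoid V) :
    x (delta (vertexElt a)) (vertexElt a) = 0 ∨ x (delta (vertexElt a)) (vertexElt a) = 1 := by
  classical
  rcases hx with rfl | rfl | ⟨⟨c, d, g⟩, rfl⟩
  · exact Or.inl rfl
  · right
    change delta (vertexElt a) (vertexElt a) = (1 : ℂ)
    simp [delta_apply]
  · by_cases h : a = d
    · subst h
      have h1 : rightMul ⟨c, a, g⟩ (delta (vertexElt a)) (vertexElt a) = _ :=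
        rightMul_apply g (𝟙 a) (delta (vertexElt a))
      rw [h1, delta_apply]
      split_ifs <;> simp
    · exact Or.inl (rightMul_apply_of_ne h _)

/-- The moment `E_π(R_{e₁}, …, R_{eₙ})` of edges. -/
def edgeMoment (π : NC n) (e : Fin n → Quiver.Total (Symmetrify V)) :
    GraphHilbert V →L[ℂ] GraphHilbert V :=
  partMoment condExp π fun j => edgeOp (e j)

theorem isGroupoidMonomial_edgeOp (t : Quiver.Total (Symmetrify V)) : IsGroupoidMonomial (edgeOp t) :=
  Or.inr (Or.inr ⟨_, rfl⟩)

theorem edgeMoment_eq_zero_or (π : NC n) (e : Fin n → Quiver.Total (Symmetrify V)) :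
    edgeMoment π e = 0 ∨ (edgeMoment π e = ((List.ofFn e).map edgeOp).prod ∧
      condExp (edgeMoment π e) = edgeMoment π e) := by
  rw [List.map_ofFn]
  exact partMoment_eq_zero_or_prod condExp π _ IsGroupoidMonomial condExp_zero condExp_one
    condExp_mul_condExp (fun _ _ hx hy => hx.mul hy) (fun j => isGroupoidMonomial_edgeOp (e j))
    fun _ hx => hx.condExp_eq

theorem isGroupoidMonomial_edgeMoment (π : NC n) (e : Fin n → Quiver.Total (Symmetrify V)) :
    IsGroupoidMonomial (edgeMoment π e) :=
  partMoment_mem condExp π _ IsGroupoidMonomial (Or.inr (Or.inl rfl)) (fun _ _ hx hy => hx.mul hy)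
    (fun x hx => by
      rcases hx.condExp_eq with h | h <;> rw [h]
      · exact hx
      · exact Or.inl rfl)
    fun j => isGroupoidMonomial_edgeOp (e j)

theorem edgeMoment_apply (π : NC n) (e : Fin n → Quiver.Total (Symmetrify V)) (f : GraphHilbert V)
    (w : GraphGroupoid V) : edgeMoment π e f w =
      edgeMoment π e (delta (vertexElt w.right)) (vertexElt w.right) * f w := by
  have h : condExp (edgeMoment π e) = edgeMoment π e := by
    rcases edgeMoment_eq_zero_or π e with h | h
    · rw [h, condExp_zero]
    · exact h.2
  nth_rw 1 [← h]
  exact condExp_apply _ _ _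

theorem tendsto_piFinset {X : Fin n → Type*} :
    Tendsto (fun s : ∀ j, Finset (X j) => Fintype.piFinset s) atTop atTop := by
  classical
  refine tendsto_atTop_atTop.2 fun G => ⟨fun j => G.image fun e => e j, fun s hs e he => ?_⟩
  exact Fintype.mem_piFinset.2 fun j => hs j (Finset.mem_image_of_mem _ he)

/-- Nested moments of labeling operators are expanded over the tuples of edges with the given
labels. Each term is diagonal with coefficients in `{0, 1}`. Hence the sums over finite sets of
tuples are dominated by those over products of finite sets of edges, and the latter are the moments
of the partial sums of the labeling operators. -/
theorem hasSum_edgeMoment [BoundedDegree V] (ω : CanonicalWeighting V) (i : Fin n → ℤ)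
    (π : NC n) (f : GraphHilbert V) :
    HasSum (fun e : ∀ j, LabeledEdge ω (i j) => edgeMoment π (fun j => (e j).1) f)
      (partMoment condExp π (fun j => labelingOp ω (i j)) f) := by
  classical
  have hlim : BoundedStrongLimit atTop (fun s : ∀ j, Finset (LabeledEdge ω (i j)) =>
      ∑ e ∈ Fintype.piFinset s, edgeMoment π fun j => (e j).1)
      (partMoment condExp π fun j => labelingOp ω (i j)) := by
    have h := BoundedStrongLimit.partMoment π fun j =>
      (boundedStrongLimit_labelingOp ω (i j)).comp (l' := atTop)
        (u := fun s : ∀ j, Finset (LabeledEdge ω (i j)) => s j)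
        (tendsto_atTop_atTop.2 fun b =>
          ⟨Function.update (fun _ => ∅) j b, fun s hs => by simpa using hs j⟩)
    have hexp : ∀ s : ∀ j, Finset (LabeledEdge ω (i j)),
        (partMoment condExp π fun j => ∑ t ∈ s j, edgeOp t.1) =
          ∑ e ∈ Fintype.piFinset s, edgeMoment π fun j => (e j).1 := fun s =>
      (partMomentMultilinear (condExpLinear V) π).map_sum_finset
        (fun j (t : LabeledEdge ω (i j)) => edgeOp t.1) s
    simpa only [hexp] using h
  obtain ⟨⟨C, hC⟩, hlim⟩ := hlim
  have hC0 : 0 ≤ C := (norm_nonneg _).trans (hC fun _ => ∅)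
  have happ : ∀ (s : Finset (∀ j, LabeledEdge ω (i j))) (g : GraphHilbert V) w,
      (∑ e ∈ s, edgeMoment π fun j => (e j).1) g w =
        ∑ e ∈ s, edgeMoment π (fun j => (e j).1) g w := fun s g w => by
    rw [sum_apply, lp_sum_apply]
  -- The real coefficients of the terms.
  let r : GraphGroupoid V → (∀ j, LabeledEdge ω (i j)) → ℝ := fun w e =>
    (edgeMoment π (fun j => (e j).1) (delta (vertexElt w.right)) (vertexElt w.right)).re
  have hr : ∀ w e, edgeMoment π (fun j => (e j).1) (delta (vertexElt w.right))
      (vertexElt w.right) = (r w e : ℂ) ∧ 0 ≤ r w e := by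
    intro w e
    rcases (isGroupoidMonomial_edgeMoment π fun j => (e j).1).coeff_eq w.right with h | h <;>
      simp only [r, h] <;> simp
  have hval : ∀ (e : ∀ j, LabeledEdge ω (i j)) (g : GraphHilbert V) w,
      edgeMoment π (fun j => (e j).1) g w = (r w e : ℂ) * g w := fun e g w => by
    rw [edgeMoment_apply, (hr w e).1]
  have hbound : ∀ w (s : Finset (∀ j, LabeledEdge ω (i j))), ∑ e ∈ s, r w e ≤ C := by
    intro w s
    obtain ⟨t, ht⟩ := (tendsto_piFinset.eventually (eventually_ge_atTop s)).exists
    refine (Finset.sum_le_sum_of_subset_of_nonneg ht fun e _ _ => (hr w e).2).trans ?_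
    have h1 := (norm_apply_delta_le _ (vertexElt w.right)).trans (hC t)
    rw [happ, Finset.sum_congr rfl fun e _ => (hr w e).1, ← Complex.ofReal_sum,
      Complex.norm_real] at h1
    exact (Real.le_norm_self _).trans h1
  refine hasSum_lp_of_dominated (h := (C : ℂ) • f) (fun s w => ?_) fun w => ?_
  · simp only [hval]
    rw [← Finset.sum_mul, ← Complex.ofReal_sum, norm_mul, Complex.norm_real,
      Real.norm_of_nonneg (Finset.sum_nonneg fun e _ => (hr w e).2)]
    change _ ≤ ‖(C : ℂ) * f w‖
    rw [norm_mul, Complex.norm_real, Real.norm_of_nonneg hC0]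
    exact mul_le_mul_of_nonneg_right (hbound w s) (norm_nonneg _)
  · have h1 : Summable (r w) := summable_of_sum_le (fun e => (hr w e).2) (hbound w)
    have h2 : HasSum (fun e => (r w e : ℂ) * f w) (((∑' e, r w e : ℝ) : ℂ) * f w) :=
      (Complex.hasSum_ofReal.2 h1.hasSum).mul_right _
    have h3 := tendsto_lp_apply (hlim f) w
    simp only [happ, hval] at h3 ⊢
    rwa [tendsto_nhds_unique h3 (h2.comp tendsto_piFinset)]

end Expansion

/-! ### The terms of the cumulant -/

section Terms

variable {V : Type u} [Quiver.{v} V] {n : ℕ}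

/-- The joint cumulant of the operators of edges. -/
def edgeCumulant (e : Fin n → Quiver.Total (Symmetrify V)) : GraphHilbert V →L[ℂ] GraphHilbert V :=
  ∑ π : NC n, NC.moebius π (NC.one n) • edgeMoment π e

theorem edgeCumulant_eq_mu_smul (hn : 1 ≤ n) (w : FinPath V) {e : Fin n → Quiver.Total (Symmetrify V)}
    (he : w.edges = List.ofFn e) : edgeCumulant e = w.mu • w.R := by
  classical
  obtain rfl : n = w.edges.length := by simp [he]
  obtain rfl : e = w.edges.get := List.ofFn_injective (by rw [← he, List.ofFn_get])
  have hne : w.edges ≠ [] := List.ne_nil_of_length_pos hn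
  have hprod : (w.edges.map edgeOp).prod = w.R := prod_edgeOp_edgesRev w.path hne
  rw [edgeCumulant, FinPath.mu, Finset.sum_smul, Finset.sum_filter]
  refine Finset.sum_congr rfl fun π _ => ?_
  change _ = if edgeMoment π w.edges.get = condExp w.R ∧ condExp w.R ≠ 0 then _ else _
  rcases edgeMoment_eq_zero_or π w.edges.get with h | ⟨h1, h2⟩
  · rw [h, smul_zero, if_neg]
    exact fun h => h.2 h.1.symm
  · rw [List.ofFn_get, hprod] at h1
    rw [h1] at h2 ⊢
    rw [h2, if_pos ⟨rfl, rightMul_ne_zero _⟩]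

theorem edgeCumulant_eq_zero (hn : 1 ≤ n) {e : Fin n → Quiver.Total (Symmetrify V)}
    (he : ∀ w : FinPath V, w.edges ≠ List.ofFn e) : edgeCumulant e = 0 := by
  refine Finset.sum_eq_zero fun π _ => ?_
  rcases edgeMoment_eq_zero_or π e with h | ⟨h, -⟩
  · rw [h, smul_zero]
  · by_cases h0 : ((List.ofFn e).map edgeOp).prod = 0
    · rw [h, h0, smul_zero]
    · have hne : List.ofFn e ≠ [] := List.ne_nil_of_length_pos (by rw [List.length_ofFn]; exact hn)
      obtain ⟨w, hw⟩ := exists_path_of_prod_edgeOp_ne_zero hne h0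
      exact absurd hw (he w)

theorem FinPath.exists_eq_vertexElt_of_mu_ne_zero {w : FinPath V} (h : w.mu ≠ 0) :
    ∃ a, (⟨_, _, reduce w.path⟩ : GraphGroupoid V) = vertexElt a := by
  classical
  by_contra! hne
  refine h (Finset.sum_eq_zero fun π hπ => ?_)
  exact absurd (condExp_rightMul_eq_zero hne) (Finset.mem_filter.1 hπ).2.2

/-- A path with `μ_w ≠ 0` reduces to a vertex, so it is closed and its labels sum up to `0`. -/
theorem FinPath.weightPlus_of_mu_ne_zero (ω : CanonicalWeighting V) {w : FinPath V}
    (h : w.mu ≠ 0) : ∃ a, w.weightPlus ω = ((a, a), 0) := by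
  obtain ⟨a, ha⟩ := FinPath.exists_eq_vertexElt_of_mu_ne_zero h
  obtain @⟨b, c, p⟩ := w
  have h1 : (⟨b⟩ : Quiver.FreeGroupoid V) = a := congrArg Quiver.Total.left ha
  have h2 : (⟨c⟩ : Quiver.FreeGroupoid V) = a := congrArg Quiver.Total.right ha
  subst h1
  injection h2 with h2
  subst h2
  refine ⟨c, Prod.ext rfl ?_⟩
  have h3 := congrArg (labelSum ω).map (eq_id_of_eq_vertexElt ha)
  have h4 := ((labelSum ω).map_id _).symm.trans (h3.symm.trans (labelSum_reduce ω p))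
  exact (Multiplicative.ofAdd.injective h4).symm

end Terms

/-! ### The cumulant of labeling operators -/

section Cumulant

variable {V : Type u} [Quiver.{v} V] {n : ℕ}

theorem FinPath.length_edges_of_mem_zeroLoops {ω : CanonicalWeighting V} {i : Fin n → ℤ}
    {w : FinPath V} (hw : w ∈ FinPath.zeroLoops ω i) : w.edges.length = n := by
  simpa [FinPath.labels] using congrArg List.length hw.1

/-- The tuple `e₁, …, eₙ` of the edges of a path `w = eₙ ⋯ e₁` in `zeroLoops ω i`. -/
def FinPath.edgeTuple {ω : CanonicalWeighting V} {i : Fin n → ℤ} (w : FinPath.zeroLoops ω i)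
    (j : Fin n) : LabeledEdge ω (i j) :=
  ⟨w.1.edges.get (j.cast (length_edges_of_mem_zeroLoops w.2).symm), by
    have h := w.2.1
    have h' : ∀ (m : ℕ) (h1 : m < (w.1.labels ω).length) (h2 : m < (List.ofFn i).length),
        (w.1.labels ω)[m] = (List.ofFn i)[m] := fun m h1 h2 => by simp only [h]
    have hj : j.val < (w.1.labels ω).length := by rw [h]; simp
    simpa [FinPath.labels] using h' j hj (by simp)⟩

theorem FinPath.ofFn_edgeTuple {ω : CanonicalWeighting V} {i : Fin n → ℤ}
    (w : FinPath.zeroLoops ω i) : w.1.edges = List.ofFn fun j => (edgeTuple w j).1 := by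
  refine List.ext_getElem ?_ fun m h1 h2 => ?_
  · simp [length_edges_of_mem_zeroLoops w.2]
  · simp [edgeTuple]

theorem FinPath.edgeTuple_injective (hn : 1 ≤ n) {ω : CanonicalWeighting V} {i : Fin n → ℤ} :
    Function.Injective (edgeTuple : FinPath.zeroLoops ω i → ∀ j, LabeledEdge ω (i j)) := by
  rintro ⟨⟨p⟩, hp⟩ ⟨⟨q⟩, hq⟩ h
  refine Subtype.ext (edgesRev_injective (List.ne_nil_of_length_pos ?_) ?_)
  · exact hn.trans_eq (length_edges_of_mem_zeroLoops hp).symm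
  · exact (ofFn_edgeTuple ⟨_, hp⟩).trans ((congrArg
      (fun e : ∀ j, LabeledEdge ω (i j) => List.ofFn fun j => (e j).1) h).trans
        (ofFn_edgeTuple ⟨_, hq⟩).symm)

/-- Only the paths in `zeroLoops ω i` contribute to the cumulant. -/
theorem edgeCumulant_eq_zero_of_notMem_range (hn : 1 ≤ n) {ω : CanonicalWeighting V}
    {i : Fin n → ℤ} {e : ∀ j, LabeledEdge ω (i j)}
    (he : e ∉ Set.range (FinPath.edgeTuple : FinPath.zeroLoops ω i → _)) :
    edgeCumulant (fun j => (e j).1) = 0 := by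
  by_cases h : ∃ w : FinPath V, w.edges = List.ofFn fun j => (e j).1
  · obtain ⟨w, hw⟩ := h
    rw [edgeCumulant_eq_mu_smul hn w hw]
    by_cases hmu : w.mu = 0
    · rw [hmu, zero_smul]
    · have hlab : w.labels ω = List.ofFn i := by
        rw [FinPath.labels, hw, List.map_ofFn]
        exact congrArg List.ofFn (funext fun j => (e j).2)
      refine absurd ⟨⟨w, hlab, FinPath.weightPlus_of_mu_ne_zero ω hmu⟩, ?_⟩ he
      have h2 := List.ofFn_injective ((FinPath.ofFn_edgeTuple
        ⟨w, hlab, FinPath.weightPlus_of_mu_ne_zero ω hmu⟩).symm.trans hw)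
      exact funext fun j => Subtype.ext (congrFun h2 j)
  · push Not at h
    exact edgeCumulant_eq_zero hn h

theorem hasSum_mu_smul_R [BoundedDegree V] (hn : 1 ≤ n) (ω : CanonicalWeighting V)
    (i : Fin n → ℤ) (f : GraphHilbert V) :
    HasSum (fun w : FinPath.zeroLoops ω i => w.1.mu • w.1.R f)
      (cumulant condExp (fun j => labelingOp ω (i j)) f) := by
  have h1 : HasSum (fun e : ∀ j, LabeledEdge ω (i j) => edgeCumulant (fun j => (e j).1) f)
      (cumulant condExp (fun j => labelingOp ω (i j)) f) := by
    have hsum : ∀ x : NC n → GraphHilbert V →L[ℂ] GraphHilbert V,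
        (∑ π, NC.moebius π (NC.one n) • x π) f = ∑ π, NC.moebius π (NC.one n) • x π f := fun x => by
      rw [sum_apply]
      rfl
    rw [cumulant, hsum]
    simp only [edgeCumulant, hsum]
    exact hasSum_sum fun π _ => (hasSum_edgeMoment ω i π f).const_smul _
  have h2 := ((FinPath.edgeTuple_injective hn).hasSum_iff fun e he => by
    rw [edgeCumulant_eq_zero_of_notMem_range hn he]
    rfl).2 h1
  have h3 : ∀ w : FinPath.zeroLoops ω i,
      edgeCumulant (fun j => (FinPath.edgeTuple w j).1) f = w.1.mu • w.1.R f := fun w => by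
    rw [edgeCumulant_eq_mu_smul hn w.1 (FinPath.ofFn_edgeTuple w)]
    rfl
  simpa only [Function.comp_def, h3] using h2

theorem labelingOp_mem_graphAlgebra [BoundedDegree V] (ω : CanonicalWeighting V) (k : ℤ) :
    labelingOp ω k ∈ graphAlgebra V :=
  mem_weakSpan_of_tendsto (boundedStrongLimit_labelingOp ω k).2 fun _ =>
    Submodule.sum_mem _ fun _ _ => Submodule.subset_span ⟨_, rfl⟩

theorem cumulant_labelingOp_mem_diagAlgebra [BoundedDegree V] (hn : 1 ≤ n)
    (ω : CanonicalWeighting V) (i : Fin n → ℤ) :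
    cumulant condExp (fun j => labelingOp ω (i j)) ∈ diagAlgebra V := by
  refine mem_weakSpan_of_tendsto (l := atTop)
    (F := fun s : Finset (FinPath.zeroLoops ω i) => ∑ w ∈ s, w.1.mu • w.1.R) (fun f => ?_)
    fun s => Submodule.sum_mem _ fun w _ => ?_
  · simp only [sum_apply]
    exact hasSum_mu_smul_R hn ω i f
  · by_cases h : w.1.mu = 0
    · rw [h, zero_smul]
      exact Submodule.zero_mem _
    · obtain ⟨a, ha⟩ := FinPath.exists_eq_vertexElt_of_mu_ne_zero h
      refine Submodule.smul_mem _ _ (Submodule.subset_span ⟨a, ?_⟩)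
      exact congrArg rightMul ha.symm

end Cumulant

end LabelingOp

end

open LabelingOp
theorem theorem5p8 {V : Type*} [Quiver V] [Countable V] [BoundedDegree V]
    (hconn : IsConnectedGraph V) (ω : CanonicalWeighting V)
    {n : ℕ} (hn : 1 ≤ n) (i : Fin n → ℤ)
    (hi : ∀ j, i j ≠ 0 ∧ |i j| ≤ (maxOutDegree V : ℤ)) :
    (∀ j, labelingOp ω (i j) ∈ graphAlgebra V) ∧
    cumulant condExp (fun j => labelingOp ω (i j)) ∈ diagAlgebra V ∧
    ∀ ξ : GraphHilbert V,
      HasSum (fun w : FinPath.zeroLoops ω i => w.1.mu • w.1.R ξ)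
        (cumulant condExp (fun j => labelingOp ω (i j)) ξ) :=
  ⟨fun j => labelingOp_mem_graphAlgebra ω (i j), cumulant_labelingOp_mem_diagAlgebra hn ω i,
    hasSum_mu_smul_R hn ω i⟩
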